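/- Let $H$ be a separable complex Hilbert space, let $A=A^*\ge\lambda_0E$ with $\lambda_0>0$ be a (generally unbounded) self-adjoint operator in $H$, and let $\kappa\in\mathbb R$ and $R_+=[0,\infty)$. Let $L_{2,\kappa}(R_+;H)$ be the space of (classes of) measurable functions $f:R_+\to H$ with finite norm $\|f\|_{L_{2,\kappa}}=\big(\int_0^\infty\|f(t)\|^2e^{-\kappa t}\,dt\big)^{1/2}$. Let $W^4_{2,\kappa}(R_+;H)$ be the space of functions $u$ with $u^{(4)}\in L_{2,\kappa}(R_+;H)$ and $A^4u\in L_{2,\kappa}(R_+;H)$, with norm $\|u\|_{W^4_{2,\kappa}}=\big(\|u^{(4)}\|^2_{L_{2,\kappa}}+\|A^4u\|^2_{L_{2,\kappa}}\big)^{1/2}$, where derivatives are taken in the sense of distributions on $(0,\infty)$. Let $\mathring W^4_{2,\kappa}(R_+;H)$ be its subspace defined by $u(0)=u'(0)=u''(0)=0$ (the continuous representatives of $u,u',u''$ vanish at $0$). Let $A_1,\dots,A_4$ be linear, generally unbounded, operators in $H$ such that $A_jA^{-j}$, $j=1,2,3,4$, are everywhere defined bounded operators in $H$. Then $$P_1u(t)=\sum_{j=1}^4A_j\,u^{(4-j)}(t)$$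 is well defined for every $u\in\mathring W^4_{2,\kappa}(R_+;H)$ and almost every $t\in R_+$ (that is, $u,u',u'',u'''$ are functions and $u^{(4-j)}(t)\in D(A_j)$ for almost every $t$), and $P_1$ is a bounded linear operator from $\mathring W^4_{2,\kappa}(R_+;H)$ into $L_{2,\kappa}(R_+;H)$: there is a constant $C$ with $\|P_1u\|_{L_{2,\kappa}}\le C\|u\|_{W^4_{2,\kappa}}$ for all $u\in\mathring W^4_{2,\kappa}(R_+;H)$. -/

import Mathlib

open MeasureTheory Set
open scoped ContDiff

noncomputable section

namespace WeightedSobolev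

section Operators

variable {H : Type*} [NormedAddCommGroup H] [InnerProductSpace ℂ H]

/-- Composition `g ∘ f` of partially defined operators on its natural domain
`{x ∈ D(f) | f x ∈ D(g)}`. -/
def opComp (g f : H →ₗ.[ℂ] H) : H →ₗ.[ℂ] H :=
  g.comp (f.domRestrict ((g.domain.comap f.toFun).map f.domain.subtype)) (by
    rintro ⟨x, ⟨y, hy, hyx⟩, hxf⟩
    have h : y = ⟨x, hxf⟩ := Subtype.ext hyx
    subst h
    exact hy)

/-- The powers `A ^ n` of a partially defined operator, on their natural domains. -/
def opPow (A : H →ₗ.[ℂ] H) : ℕ → (H →ₗ.[ℂ] H)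
  | 0 => (LinearMap.id : H →ₗ[ℂ] H).toPMap ⊤
  | n + 1 => opComp (opPow A n) A

/-- A partially defined operator is bounded in `H`: it is defined on all of `H` and satisfies a
norm bound. -/
def IsBoundedIn (T : H →ₗ.[ℂ] H) : Prop :=
  T.domain = ⊤ ∧ ∃ C : ℝ, ∀ x : T.domain, ‖T x‖ ≤ C * ‖(x : H)‖

theorem mem_graph_opComp (g f : H →ₗ.[ℂ] H) (x z : H) :
    (x, z) ∈ (opComp g f).graph ↔ ∃ y, (x, y) ∈ f.graph ∧ (y, z) ∈ g.graph := by
  simp only [LinearPMap.mem_graph_iff]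
  constructor
  · rintro ⟨⟨a, ⟨⟨b, hb, hba⟩, haf⟩⟩, hax, haz⟩
    simp only at hax
    subst hax
    exact ⟨f ⟨a, haf⟩, ⟨⟨a, haf⟩, rfl, rfl⟩, ⟨⟨f ⟨a, haf⟩, by
      have : b = ⟨a, haf⟩ := Subtype.ext hba
      subst this; exact hb⟩, rfl, haz⟩⟩
  · rintro ⟨y, ⟨a, rfl, rfl⟩, ⟨b, hb, rfl⟩⟩
    refine ⟨⟨a, ⟨a, ?_, rfl⟩, a.2⟩, rfl, ?_⟩
    · change f a ∈ g.domain
      rw [← hb]; exact b.2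
    · exact congrArg g (Subtype.ext hb.symm)

end Operators

section Spaces

variable {H : Type*} [NormedAddCommGroup H] [InnerProductSpace ℂ H]

/-- The measure `e^{-κ t} dt` on `R₊ = [0, ∞)`. -/
def weightedMeasure (κ : ℝ) : Measure ℝ :=
  (volume.restrict (Ici (0 : ℝ))).withDensity fun t => ENNReal.ofReal (Real.exp (-κ * t))

theorem ae_weightedMeasure (κ : ℝ) :
    ae (weightedMeasure κ) = ae (volume.restrict (Ioi (0 : ℝ))) := by
  rw [restrict_Ioi_eq_restrict_Ici]
  apply le_antisymm
  · exact (withDensity_absolutelyContinuous _ _).ae_le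
  · refine (withDensity_absolutelyContinuous' ?_ ?_).ae_le
    · fun_prop
    · exact ae_of_all _ fun t => (ENNReal.ofReal_pos.mpr (Real.exp_pos _)).ne'

variable (H) in
/-- `L_{2,κ}(R₊; H)`, with norm `(∫₀^∞ ‖f(t)‖² e^{-κ t} dt)^{1/2}`. -/
abbrev L2w (κ : ℝ) : Type _ := Lp H 2 (weightedMeasure κ)

/-- `v` is the derivative of order `k` of `u` on `(0, ∞)` in the sense of distributions, both being
locally integrable there. (The test functions vanish outside `(0, ∞)`, so the values of `u` and `v`
outside `(0, ∞)` play no role.) -/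
structure HasWeakDeriv (k : ℕ) (u v : ℝ → H) : Prop where
  left : LocallyIntegrableOn u (Ioi 0)
  right : LocallyIntegrableOn v (Ioi 0)
  eq : ∀ φ : ℝ → ℝ, ContDiff ℝ ∞ φ → HasCompactSupport φ → tsupport φ ⊆ Ioi 0 →
    ∫ t, iteratedDeriv k φ t • u t = (-1 : ℝ) ^ k • ∫ t, φ t • v t

theorem integrable_test_smul {u : ℝ → H} (hu : LocallyIntegrableOn u (Ioi 0)) {φ : ℝ → ℝ}
    (hφ : Continuous φ) (hc : HasCompactSupport φ) (hs : tsupport φ ⊆ Ioi 0) :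
    Integrable fun t => φ t • u t := by
  have h1 : IntegrableOn u (tsupport φ) := hu.integrableOn_compact_subset hs hc
  have h2 : IntegrableOn (fun t => φ t • u t) (tsupport φ) :=
    h1.continuousOn_smul hφ.continuousOn hc
  refine (integrableOn_iff_integrable_of_support_subset ?_).mp h2
  intro t ht
  apply subset_tsupport φ
  intro h0
  exact ht (by simp [h0])

theorem integrable_iteratedDeriv_smul {u : ℝ → H} (hu : LocallyIntegrableOn u (Ioi 0)) {φ : ℝ → ℝ}
    (k : ℕ) (hφ : ContDiff ℝ ∞ φ) (hc : HasCompactSupport φ) (hs : tsupport φ ⊆ Ioi 0) :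
    Integrable fun t => iteratedDeriv k φ t • u t := by
  have hsub : tsupport (iteratedDeriv k φ) ⊆ tsupport φ := by
    apply closure_minimal _ (isClosed_tsupport φ)
    intro t ht
    apply support_iteratedFDeriv_subset (𝕜 := ℝ) k
    intro h0
    exact ht (by simp [iteratedDeriv, h0])
  refine integrable_test_smul hu (hφ.continuous_iteratedDeriv k (by exact_mod_cast le_top)) ?_
    (hsub.trans hs)
  exact hc.of_isClosed_subset (isClosed_tsupport _) hsub

theorem HasWeakDeriv.zero (k : ℕ) : HasWeakDeriv k (0 : ℝ → H) 0 :=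
  ⟨locallyIntegrableOn_zero, locallyIntegrableOn_zero, by simp⟩

theorem HasWeakDeriv.add {k : ℕ} {u u' v v' : ℝ → H} (h : HasWeakDeriv k u v)
    (h' : HasWeakDeriv k u' v') : HasWeakDeriv k (u + u') (v + v') := by
  refine ⟨h.left.add h'.left, h.right.add h'.right, fun φ hφ hc hs => ?_⟩
  simp only [Pi.add_apply, smul_add]
  rw [integral_add (integrable_iteratedDeriv_smul h.left k hφ hc hs)
    (integrable_iteratedDeriv_smul h'.left k hφ hc hs),
    integral_add (integrable_test_smul h.right hφ.continuous hc hs)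
    (integrable_test_smul h'.right hφ.continuous hc hs), h.eq φ hφ hc hs, h'.eq φ hφ hc hs,
    smul_add]

theorem HasWeakDeriv.smul {k : ℕ} {u v : ℝ → H} (c : ℂ) (h : HasWeakDeriv k u v) :
    HasWeakDeriv k (c • u) (c • v) := by
  refine ⟨h.left.smul c, h.right.smul c, fun φ hφ hc hs => ?_⟩
  simp only [Pi.smul_apply]
  simp_rw [fun (r : ℝ) (x : H) => smul_comm r c x]
  rw [integral_smul, integral_smul, h.eq φ hφ hc hs, smul_comm]

theorem HasWeakDeriv.congr {k : ℕ} {u u' v v' : ℝ → H} (h : HasWeakDeriv k u v)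
    (hu : u =ᵐ[volume.restrict (Ioi 0)] u') (hv : v =ᵐ[volume.restrict (Ioi 0)] v') :
    HasWeakDeriv k u' v' := by
  have key : ∀ {w w' : ℝ → H}, w =ᵐ[volume.restrict (Ioi 0)] w' →
      LocallyIntegrableOn w (Ioi 0) → LocallyIntegrableOn w' (Ioi 0) := by
    intro w w' hw hl
    rw [locallyIntegrableOn_iff isOpen_Ioi.isLocallyClosed] at hl ⊢
    intro K hK hKc
    exact (hl K hK hKc).congr (ae_mono (Measure.restrict_mono hK le_rfl) hw)
  have int : ∀ {w w' : ℝ → H} {ψ : ℝ → ℝ}, w =ᵐ[volume.restrict (Ioi 0)] w' →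
      (∀ t, t ∉ Ioi (0 : ℝ) → ψ t = 0) → ∫ t, ψ t • w t = ∫ t, ψ t • w' t := by
    intro w w' ψ hw hψ
    rw [Filter.EventuallyEq, ae_restrict_iff' measurableSet_Ioi] at hw
    apply integral_congr_ae
    filter_upwards [hw] with t ht
    by_cases h0 : t ∈ Ioi (0 : ℝ)
    · rw [ht h0]
    · simp [hψ t h0]
  refine ⟨key hu h.left, key hv h.right, fun φ hφ hc hs => ?_⟩
  rw [← int hu, ← int hv, h.eq φ hφ hc hs]
  · intro t ht
    exact image_eq_zero_of_notMem_tsupport fun h1 => ht (hs h1)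
  · intro t ht
    by_contra h0
    refine ht (hs (support_iteratedFDeriv_subset (𝕜 := ℝ) k ?_))
    intro h1
    exact h0 (by simp [iteratedDeriv, h1])

/-- Distributional derivatives are unique. -/
theorem HasWeakDeriv.unique [CompleteSpace H] {k : ℕ} {u v v' : ℝ → H} (h : HasWeakDeriv k u v)
    (h' : HasWeakDeriv k u v') : v =ᵐ[volume.restrict (Ioi 0)] v' := by
  have := isOpen_Ioi.ae_eq_zero_of_integral_contDiff_smul_eq_zero (μ := volume)
    (h.right.sub h'.right) (fun φ hφ hc hs => by
      simp only [Pi.sub_apply, smul_sub]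
      rw [integral_sub (integrable_test_smul h.right hφ.continuous hc hs)
        (integrable_test_smul h'.right hφ.continuous hc hs), sub_eq_zero]
      have := (h.eq φ hφ hc hs).symm.trans (h'.eq φ hφ hc hs)
      exact smul_right_injective H (pow_ne_zero k (by norm_num : (-1 : ℝ) ≠ 0)) this)
  rw [Filter.EventuallyEq, ae_restrict_iff' measurableSet_Ioi]
  filter_upwards [this] with t ht h0
  exact sub_eq_zero.mp (ht h0)

/-- `W^4_{2,κ}(R₊; H)`: the functions `u` with `u'''' ∈ L_{2,κ}` (distributional derivative) and
`A⁴ u ∈ L_{2,κ}`. As `A` is boundedly invertible, such a `u` lies in `L_{2,κ}` itself. -/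
def W4 (A : H →ₗ.[ℂ] H) (κ : ℝ) : Submodule ℂ (L2w H κ) where
  carrier := {u | (∃ v : L2w H κ, HasWeakDeriv 4 u v) ∧
    ∃ w : L2w H κ, ∀ᵐ t ∂(weightedMeasure κ), (u t, w t) ∈ (opPow A 4).graph}
  zero_mem' := by
    have h0 : ((0 : L2w H κ) : ℝ → H) =ᵐ[weightedMeasure κ] 0 := Lp.coeFn_zero _ _ _
    refine ⟨⟨0, (HasWeakDeriv.zero 4).congr ?_ ?_⟩, 0, ?_⟩
    · rw [Filter.EventuallyEq, ← ae_weightedMeasure κ]; exact h0.symm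
    · rw [Filter.EventuallyEq, ← ae_weightedMeasure κ]; exact h0.symm
    · filter_upwards [h0] with t ht
      rw [ht]
      exact (opPow A 4).graph.zero_mem
  add_mem' := by
    rintro u u' ⟨⟨v, hv⟩, w, hw⟩ ⟨⟨v', hv'⟩, w', hw'⟩
    refine ⟨⟨v + v', (hv.add hv').congr ?_ ?_⟩, w + w', ?_⟩
    · rw [Filter.EventuallyEq, ← ae_weightedMeasure κ]; exact (Lp.coeFn_add u u').symm
    · rw [Filter.EventuallyEq, ← ae_weightedMeasure κ]; exact (Lp.coeFn_add v v').symm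
    · filter_upwards [hw, hw', Lp.coeFn_add u u', Lp.coeFn_add w w'] with t h1 h2 h3 h4
      rw [h3, h4]
      exact (opPow A 4).graph.add_mem h1 h2
  smul_mem' := by
    rintro c u ⟨⟨v, hv⟩, w, hw⟩
    refine ⟨⟨c • v, (hv.smul c).congr ?_ ?_⟩, c • w, ?_⟩
    · rw [Filter.EventuallyEq, ← ae_weightedMeasure κ]; exact (Lp.coeFn_smul c u).symm
    · rw [Filter.EventuallyEq, ← ae_weightedMeasure κ]; exact (Lp.coeFn_smul c v).symm
    · filter_upwards [hw, Lp.coeFn_smul c u, Lp.coeFn_smul c w] with t h1 h3 h4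
      rw [h3, h4]
      exact (opPow A 4).graph.smul_mem c h1

/-- `u^{(s)}(0) = 0`: the derivative of order `s` of `u` has a representative that is continuous on
`[0, ∞)` and vanishes at `0`. -/
def HasZeroTrace (s : ℕ) (u : ℝ → H) : Prop :=
  ∃ g : ℝ → H, HasWeakDeriv s u g ∧ ContinuousOn g (Ici 0) ∧ g 0 = 0

/-- The subspace of `W^4_{2,κ}(R₊; H)` given by `u(0) = u'(0) = u''(0) = 0`. -/
def W4Zero (A : H →ₗ.[ℂ] H) (κ : ℝ) : Submodule ℂ (L2w H κ) where
  carrier := {u | u ∈ W4 A κ ∧ ∀ s < 3, HasZeroTrace s u}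
  zero_mem' := by
    refine ⟨zero_mem _, fun s _ => ⟨0, (HasWeakDeriv.zero s).congr ?_ (ae_eq_refl _),
      continuousOn_const, rfl⟩⟩
    rw [Filter.EventuallyEq, ← ae_weightedMeasure κ]; exact (Lp.coeFn_zero _ _ _).symm
  add_mem' := by
    rintro u u' ⟨hu, h⟩ ⟨hu', h'⟩
    refine ⟨add_mem hu hu', fun s hs => ?_⟩
    obtain ⟨g, hg, hgc, hg0⟩ := h s hs
    obtain ⟨g', hg', hgc', hg0'⟩ := h' s hs
    refine ⟨g + g', (hg.add hg').congr ?_ (ae_eq_refl _), hgc.add hgc', by simp [hg0, hg0']⟩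
    rw [Filter.EventuallyEq, ← ae_weightedMeasure κ]; exact (Lp.coeFn_add u u').symm
  smul_mem' := by
    rintro c u ⟨hu, h⟩
    refine ⟨Submodule.smul_mem _ c hu, fun s hs => ?_⟩
    obtain ⟨g, hg, hgc, hg0⟩ := h s hs
    refine ⟨c • g, (hg.smul c).congr ?_ (ae_eq_refl _), hgc.const_smul c, by simp [hg0]⟩
    rw [Filter.EventuallyEq, ← ae_weightedMeasure κ]; exact (Lp.coeFn_smul c u).symm

/-- The fourth derivative of `u ∈ W^4_{2,κ}`, as an element of `L_{2,κ}`. -/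
def deriv4 {A : H →ₗ.[ℂ] H} {κ : ℝ} (u : W4 A κ) : L2w H κ := u.2.1.choose

/-- `A⁴ u` for `u ∈ W^4_{2,κ}`, as an element of `L_{2,κ}`. -/
def pow4 {A : H →ₗ.[ℂ] H} {κ : ℝ} (u : W4 A κ) : L2w H κ := u.2.2.choose

theorem deriv4_eq [CompleteSpace H] {A : H →ₗ.[ℂ] H} {κ : ℝ} (u : W4 A κ) (v : L2w H κ)
    (hv : HasWeakDeriv 4 (u : L2w H κ) v) : deriv4 u = v := by
  apply Lp.ext
  rw [Filter.EventuallyEq, ae_weightedMeasure κ]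
  exact HasWeakDeriv.unique u.2.1.choose_spec hv

theorem pow4_eq {A : H →ₗ.[ℂ] H} {κ : ℝ} (u : W4 A κ) (w : L2w H κ)
    (hw : ∀ᵐ t ∂(weightedMeasure κ), ((u : L2w H κ) t, w t) ∈ (opPow A 4).graph) :
    pow4 u = w := by
  apply Lp.ext
  filter_upwards [u.2.2.choose_spec, hw] with t h1 h2
  exact LinearPMap.mem_graph_snd_inj _ h1 h2 rfl

/-- The norm `(‖u''''‖² + ‖A⁴ u‖²)^{1/2}` of `W^4_{2,κ}(R₊; H)`, with `L_{2,κ}` norms on the right. -/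
def W4norm {A : H →ₗ.[ℂ] H} {κ : ℝ} (u : W4 A κ) : ℝ :=
  Real.sqrt (‖deriv4 u‖ ^ 2 + ‖pow4 u‖ ^ 2)

/-- `f(t) = ∑_{j=1}^4 A_j u^{(4-j)}(t)` for almost every `t ∈ R₊`, where the distributional
derivatives `u^{(k)}`, `k ≤ 3`, are functions and `u^{(4-j)}(t)` lies in the domain of `A_j` for
almost every `t`. -/
def IsPerturbation (B : ℕ → (H →ₗ.[ℂ] H)) (κ : ℝ) (u f : ℝ → H) : Prop :=
  ∃ d : ℕ → ℝ → H, (∀ k < 4, HasWeakDeriv k u (d k)) ∧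
    ∀ᵐ t ∂(weightedMeasure κ), ∃ y : ℕ → H,
      (∀ j ∈ Finset.Icc 1 4, (d (4 - j) t, y j) ∈ (B j).graph) ∧
      f t = ∑ j ∈ Finset.Icc 1 4, y j

end Spaces

end WeightedSobolev

end

/-! The point is an intermediate derivative theorem: `A ^ j u^{(4-j)}` lies in `L_{2,κ}` with norm
controlled by `‖u''''‖ + ‖A⁴u‖`. The theorem then follows from `A_j u^{(4-j)} = (A_j A⁻ʲ)(A ^ j
u^{(4-j)})`, the first factor being bounded.

Let `T = A⁻¹`, bounded, symmetric and nonnegative. The unbounded `A` is replaced by the bounded `G =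
(T + ε)⁻¹`. Integration by parts in the weighted space gives, for `k < 3`, `⟨u^{(k+1)}, Gⁿ
u^{(k+1)}⟩ + ⟨u^{(k)}, Gⁿ u^{(k+2)}⟩ = κ ⟨u^{(k)}, Gⁿ u^{(k+1)}⟩`; the boundary term at `0` vanishes
because `u^{(k)}(0) = 0`. With `n = 2(3 - k)` and `a k = ‖G^(4-k) u^{(k)}‖` this yields `a (k+1)² ≤
a k (a (k+2) + K a (k+1))`, where `K = |κ|(‖T‖ + 1)` does not depend on `ε ≤ 1`
(`energy_inequality`). Elementary algebra bounds `a 1, a 2, a 3` by `a 0 + a 4`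
(`interpolation_bound`), and `a 0 ≤ ‖A⁴u‖` because `G T` is a contraction. The bounds are uniform in
`ε`, so duality as `ε → 0` places `u^{(k+1)}` in the range of `T^(3-k)`
(`exists_preimage_of_resolvent_bound`).

The identity presupposes that `u', u'', u'''` have good representatives in `L_{2,κ}`. A du
Bois-Reymond argument provides iterated primitives (`HasWeakDeriv.exists_derivatives`), and a local
estimate averaged over unit intervals gives square integrability (`memLp_derivatives`). -/

noncomputable section

namespace WeightedSobolev

/-! ### The bounded inverse of `A` and its powers. -/

section Inverse

variable {H : Type*} [NormedAddCommGroup H] [InnerProductSpace ℂ H]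

/-- A coercive self-adjoint operator has an everywhere defined, bounded, symmetric and nonnegative
inverse. -/
theorem exists_bounded_inverse [CompleteSpace H] (A : H →ₗ.[ℂ] H) (hA : IsSelfAdjoint A)
    {lam : ℝ} (hlam : 0 < lam)
    (hpos : ∀ x : A.domain, lam * ‖(x : H)‖ ^ 2 ≤ (inner ℂ (A x) (x : H)).re) :
    ∃ T : H →L[ℂ] H, (∀ x y, (x, y) ∈ A.graph ↔ T y = x) ∧
      (∀ x y, inner ℂ (T x) y = inner ℂ x (T y)) ∧ ∀ x, 0 ≤ (inner ℂ (T x) x).re := by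
  have hsymm : ∀ x y : A.domain, inner ℂ (A x) (y : H) = inner ℂ (x : H) (A y) := by
    have h := A.adjoint_isFormalAdjoint hA.dense_domain
    rw [LinearPMap.isSelfAdjoint_def.mp hA] at h
    exact h
  have hbound : ∀ p : A.graph, ‖(p : H × H).1‖ ≤ lam⁻¹ * ‖(p : H × H).2‖ := by
    rintro ⟨⟨x, y⟩, hp⟩
    obtain ⟨a, rfl, rfl⟩ := (LinearPMap.mem_graph_iff A).mp hp
    have h1 : lam * ‖(a : H)‖ ^ 2 ≤ ‖A a‖ * ‖(a : H)‖ :=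
      (hpos a).trans ((Complex.re_le_norm _).trans (norm_inner_le_norm _ _))
    rw [inv_mul_eq_div, le_div_iff₀ hlam]
    rcases (norm_nonneg (a : H)).eq_or_lt with h0 | h0
    · simp only [← h0, zero_mul]; positivity
    · exact le_of_mul_le_mul_right (by nlinarith) h0
  -- `A` is studied as the second projection of its graph. The graph is complete because a
  -- self-adjoint operator is closed, so a lower bound on `S` makes the range closed.
  let S : A.graph →ₗ[ℂ] H := (LinearMap.snd ℂ H H).domRestrict A.graph
  have hSinj : Function.Injective S := by
    rw [← LinearMap.ker_eq_bot, LinearMap.ker_eq_bot']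
    rintro p hp
    have h2 : (p : H × H).2 = 0 := hp
    have h1 : (p : H × H).1 = 0 := by
      have := hbound p
      rw [h2, norm_zero, mul_zero] at this
      exact norm_le_zero_iff.mp this
    exact Subtype.ext (Prod.ext h1 h2)
  have hSclosed : IsClosed (S.range : Set H) := by
    have : CompleteSpace A.graph := (show IsClosed (A.graph : Set (H × H)) from
      hA.isClosed).completeSpace_coe
    have hanti : AntilipschitzWith (max lam⁻¹ 1).toNNReal S := by
      refine AddMonoidHomClass.antilipschitz_of_bound S fun p => ?_
      rw [Real.coe_toNNReal _ (by positivity)]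
      refine max_le ((hbound p).trans ?_) ?_
      · exact mul_le_mul_of_nonneg_right (le_max_left _ _) (norm_nonneg _)
      · exact le_mul_of_one_le_left (norm_nonneg _) (le_max_right _ _)
    have huc : UniformContinuous S := by
      exact (uniformContinuous_snd).comp uniformContinuous_subtype_val
    exact hanti.isClosed_range huc
  have hSsurj : Function.Surjective S := by
    rw [← LinearMap.range_eq_top]
    have : CompleteSpace S.range := hSclosed.completeSpace_coe
    -- A vector `y` orthogonal to the range lies in `D(A*) = D(A)`, and coercivity at `y` then
    -- forces `y = 0`.
    rw [← Submodule.orthogonal_eq_bot_iff, Submodule.eq_bot_iff]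
    intro y hy
    have hy' : ∀ x : A.domain, inner ℂ y (A x) = 0 := fun x => by
      rw [← inner_conj_symm, (Submodule.mem_orthogonal _ y).mp hy (A x)
        ⟨⟨(x, A x), A.mem_graph x⟩, rfl⟩, map_zero]
    have hyd : y ∈ A.domain := by
      have := A.mem_adjoint_domain_of_exists y ⟨0, fun x => by rw [hy' x, inner_zero_left]⟩
      rwa [LinearPMap.isSelfAdjoint_def.mp hA] at this
    have h1 := hpos ⟨y, hyd⟩
    rw [hsymm, hy' ⟨y, hyd⟩, Complex.zero_re] at h1
    have h2 : ‖y‖ ^ 2 ≤ 0 := nonpos_of_mul_nonpos_right h1 hlam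
    exact norm_eq_zero.mp (pow_eq_zero_iff two_ne_zero |>.mp (le_antisymm h2 (sq_nonneg _)))
  let e := LinearEquiv.ofBijective S ⟨hSinj, hSsurj⟩
  have he : ∀ y, ((e.symm y : A.graph) : H × H).2 = y := fun y => e.apply_symm_apply y
  let T : H →L[ℂ] H := LinearMap.mkContinuous
    ((LinearMap.fst ℂ H H).domRestrict A.graph ∘ₗ e.symm.toLinearMap) lam⁻¹ fun y => by
      have := hbound (e.symm y)
      rwa [he] at this
  have hT : ∀ y, (T y, y) ∈ A.graph := fun y => by
    have h1 : (T y, y) = ((e.symm y : A.graph) : H × H) := Prod.ext rfl (he y).symm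
    rw [h1]; exact (e.symm y).2
  have hTiff : ∀ x y, (x, y) ∈ A.graph ↔ T y = x := by
    refine fun x y => ⟨fun h => ?_, fun h => h ▸ hT y⟩
    have := @hSinj ⟨_, hT y⟩ ⟨_, h⟩ rfl
    exact congrArg (fun p : A.graph => (p : H × H).1) this
  have hTd : ∀ y, ∃ h : T y ∈ A.domain, A ⟨T y, h⟩ = y := fun y => by
    obtain ⟨a, h1, h2⟩ := (LinearPMap.mem_graph_iff A).mp (hT y)
    exact ⟨(show (a : H) = T y from h1) ▸ a.2, (congrArg A (Subtype.ext h1.symm)).trans h2⟩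
  refine ⟨T, hTiff, fun x y => ?_, fun x => ?_⟩
  · obtain ⟨hx, hx'⟩ := hTd x
    obtain ⟨hy, hy'⟩ := hTd y
    have := hsymm ⟨T x, hx⟩ ⟨T y, hy⟩
    rw [hx', hy'] at this
    exact this.symm
  · obtain ⟨hx, hx'⟩ := hTd x
    have := hpos ⟨T x, hx⟩
    rw [hx', ← inner_conj_symm, Complex.conj_re] at this
    exact le_trans (by positivity) this

/-- If `T` is the inverse of `A`, then `T ^ n` is the inverse of `A ^ n`. -/
theorem mem_graph_opPow {A : H →ₗ.[ℂ] H} {T : H →L[ℂ] H}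
    (hT : ∀ x y, (x, y) ∈ A.graph ↔ T y = x) (n : ℕ) (x y : H) :
    (x, y) ∈ (opPow A n).graph ↔ (T ^ n) y = x := by
  induction n generalizing x y with
  | zero =>
    simp only [opPow, LinearPMap.mem_graph_iff, pow_zero, one_apply_eq_self]
    constructor
    · rintro ⟨a, rfl, rfl⟩; rfl
    · rintro rfl; exact ⟨⟨y, trivial⟩, rfl, rfl⟩
  | succ n ih =>
    rw [opPow, mem_graph_opComp, pow_succ']
    constructor
    · rintro ⟨z, h1, h2⟩
      rw [mul_apply_eq_comp, (ih z y).mp h2, (hT x z).mp h1]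
    · intro h
      exact ⟨(T ^ n) y, (hT _ _).mpr h, (ih _ _).mpr rfl⟩

/-- If `B A⁻ⁿ` is bounded in `H`, it is given by a continuous linear operator. -/
theorem exists_clm_of_isBoundedIn {A : H →ₗ.[ℂ] H} {T : H →L[ℂ] H}
    (hT : ∀ x y, (x, y) ∈ A.graph ↔ T y = x) (n : ℕ) (B : H →ₗ.[ℂ] H)
    (hB : IsBoundedIn (opComp B (opPow A n).inverse)) :
    ∃ Q : H →L[ℂ] H, ∀ y, ((T ^ n) y, Q y) ∈ B.graph := by
  -- The graph of `LinearPMap.inverse` is the flipped graph only when the kernel is trivial.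
  have hker : (opPow A n).toFun.ker = ⊥ := by
    rw [LinearMap.ker_eq_bot']
    intro x hx
    have h := (opPow A n).mem_graph x
    rw [show (opPow A n) x = 0 from hx, mem_graph_opPow hT, map_zero] at h
    exact Subtype.ext h.symm
  obtain ⟨hdom, C, hC⟩ := hB
  set F := opComp B (opPow A n).inverse
  let Q : H →L[ℂ] H := LinearMap.mkContinuous
    (F.toFun ∘ₗ LinearMap.codRestrict F.domain LinearMap.id fun y => hdom ▸ Submodule.mem_top) C
    fun y => hC ⟨y, hdom ▸ Submodule.mem_top⟩
  refine ⟨Q, fun y => ?_⟩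
  have hy : (y, Q y) ∈ F.graph := F.mem_graph ⟨y, hdom ▸ Submodule.mem_top⟩
  obtain ⟨z, h1, h2⟩ := (mem_graph_opComp _ _ _ _).mp hy
  rw [LinearPMap.inverse_graph hker, Submodule.mem_map] at h1
  obtain ⟨⟨a, b⟩, hab, he⟩ := h1
  simp only [LinearEquiv.coe_coe, LinearEquiv.prodComm_apply, Prod.swap_prod_mk,
    Prod.mk.injEq] at he
  obtain ⟨rfl, rfl⟩ := he
  rwa [(mem_graph_opPow hT n _ _).mp hab]

end Inverse

/-! ### Resolvent regularization and the abstract intermediate derivative estimate. -/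

section Regularization

variable {E : Type*} [NormedAddCommGroup E] [InnerProductSpace ℂ E]

theorem inner_pow_apply_left {T : E →L[ℂ] E} (hT : ∀ x y, inner ℂ (T x) y = inner ℂ x (T y))
    (n : ℕ) (x y : E) : inner ℂ ((T ^ n) x) y = inner ℂ x ((T ^ n) y) := by
  induction n generalizing x y with
  | zero => simp
  | succ n ih =>
    rw [pow_succ', mul_apply_eq_comp, hT, ih, ← mul_apply_eq_comp, ← pow_succ, ← pow_succ']

/-- `T + ε` is invertible for a nonnegative symmetric operator `T` and `ε > 0`. -/
theorem exists_resolvent [CompleteSpace E] {T : E →L[ℂ] E}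
    (hT : ∀ x y, inner ℂ (T x) y = inner ℂ x (T y)) (hT0 : ∀ x, 0 ≤ (inner ℂ (T x) x).re)
    {ε : ℝ} (hε : 0 < ε) :
    ∃ G : E →L[ℂ] E, G * (T + (ε : ℂ) • 1) = 1 ∧ (T + (ε : ℂ) • 1) * G = 1 := by
  have hp : 0 ≤ T := by
    rw [ContinuousLinearMap.nonneg_iff_isPositive, ContinuousLinearMap.isPositive_def]
    exact ⟨fun x y => hT x y, hT0⟩
  -- The spectrum of a nonnegative operator contains no negative number.
  have hu : IsUnit (algebraMap ℝ (E →L[ℂ] E) (-ε) - T) := by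
    by_contra h
    exact absurd (spectrum_nonneg_of_nonneg hp (spectrum.mem_iff.mpr h)) (by linarith)
  have he : algebraMap ℝ (E →L[ℂ] E) (-ε) - T = -(T + (ε : ℂ) • 1) := by
    rw [Algebra.algebraMap_eq_smul_one]
    ext x
    simp [sub_eq_add_neg, add_comm]
  rw [he, IsUnit.neg_iff] at hu
  obtain ⟨U, hU⟩ := hu
  exact ⟨(U⁻¹ : (E →L[ℂ] E)ˣ), by rw [← hU, Units.inv_mul], by rw [← hU, Units.mul_inv]⟩

/-- In the expansion of the squared right-hand side the cross term `2ε Re⟨Tx, x⟩` is nonnegative.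
This is what makes `G T` a contraction. -/
theorem norm_apply_le_norm_apply_add_smul {T : E →L[ℂ] E}
    (hT0 : ∀ x, 0 ≤ (inner ℂ (T x) x).re) {ε : ℝ} (hε : 0 ≤ ε) (x : E) :
    ‖T x‖ ≤ ‖T x + (ε : ℂ) • x‖ := by
  refine le_of_sq_le_sq ?_ (norm_nonneg _)
  rw [norm_add_sq (𝕜 := ℂ), inner_smul_right]
  have : 0 ≤ RCLike.re ((ε : ℂ) * inner ℂ (T x) x) := by
    simpa using mul_nonneg hε (hT0 x)
  nlinarith [sq_nonneg ‖(ε : ℂ) • x‖]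

section Resolvent

variable {T G : E →L[ℂ] E} {ε : ℝ}

theorem resolvent_commute (hG : G * (T + (ε : ℂ) • 1) = 1) (hG' : (T + (ε : ℂ) • 1) * G = 1) :
    Commute G T := by
  rw [mul_add] at hG
  rw [add_mul] at hG'
  simp only [mul_smul_comm, smul_mul_assoc, mul_one, one_mul] at hG hG'
  exact add_right_cancel (hG.trans hG'.symm)

theorem inner_resolvent_left (hT : ∀ x y, inner ℂ (T x) y = inner ℂ x (T y))
    (hG' : (T + (ε : ℂ) • 1) * G = 1) (x y : E) :
    inner ℂ (G x) y = inner ℂ x (G y) := by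
  have h : ∀ z, T (G z) + (ε : ℂ) • G z = z := fun z => by
    simpa using congrArg (fun S : E →L[ℂ] E => S z) hG'
  calc inner ℂ (G x) y = inner ℂ (G x) (T (G y) + (ε : ℂ) • G y) := by rw [h]
    _ = inner ℂ (T (G x) + (ε : ℂ) • G x) (G y) := by
      rw [inner_add_right, inner_add_left, hT, inner_smul_left, inner_smul_right,
        Complex.conj_ofReal]
    _ = inner ℂ x (G y) := by rw [h]

theorem norm_resolvent_pow_apply_le (hT0 : ∀ x, 0 ≤ (inner ℂ (T x) x).re) (hε : 0 ≤ ε)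
    (hG : G * (T + (ε : ℂ) • 1) = 1) (hG' : (T + (ε : ℂ) • 1) * G = 1) (n : ℕ) (x : E) :
    ‖(G ^ n) ((T ^ n) x)‖ ≤ ‖x‖ := by
  have hc := resolvent_commute hG hG'
  have h1 : ∀ x, ‖(G * T) x‖ ≤ ‖x‖ := fun x => by
    rw [hc.eq, mul_apply_eq_comp]
    refine (norm_apply_le_norm_apply_add_smul hT0 hε (G x)).trans_eq ?_
    have : T (G x) + (ε : ℂ) • G x = x := by
      simpa using congrArg (fun S : E →L[ℂ] E => S x) hG'
    rw [this]
  rw [← mul_apply_eq_comp, ← hc.mul_pow]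
  induction n with
  | zero => simp
  | succ n ih =>
    rw [pow_succ', mul_apply_eq_comp]
    exact (h1 _).trans ih

/-- A lower bound on `G` uniform in `ε ≤ 1`, replacing the coercivity of `A`: a missing power of `G`
can be restored at the cost of `‖T‖ + 1`. -/
theorem norm_le_mul_norm_resolvent_apply (hε : 0 ≤ ε) (hε1 : ε ≤ 1)
    (hG' : (T + (ε : ℂ) • 1) * G = 1) (x : E) : ‖x‖ ≤ (‖T‖ + 1) * ‖G x‖ := by
  have h : T (G x) + (ε : ℂ) • G x = x := by
    simpa using congrArg (fun S : E →L[ℂ] E => S x) hG'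
  calc ‖x‖ = ‖T (G x) + (ε : ℂ) • G x‖ := by rw [h]
    _ ≤ ‖T‖ * ‖G x‖ + ε * ‖G x‖ := by
      refine (norm_add_le _ _).trans (add_le_add (T.le_opNorm _) ?_)
      rw [norm_smul, Complex.norm_real, Real.norm_of_nonneg hε]
    _ ≤ (‖T‖ + 1) * ‖G x‖ := by nlinarith [norm_nonneg (G x)]

end Resolvent

/-- If the regularizations `(T + ε)⁻ⁿ x` are bounded by `M` for small `ε`, then `x` lies in the
range of `T ^ n`, with a preimage of norm at most `M`. -/
theorem exists_preimage_of_resolvent_bound [CompleteSpace E] {T : E →L[ℂ] E}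
    (hT : ∀ x y, inner ℂ (T x) y = inner ℂ x (T y)) (hinj : Function.Injective T)
    (n : ℕ) (x : E) {M : ℝ} (hM : 0 ≤ M)
    (h : ∀ ε : ℝ, 0 < ε → ε ≤ 1 → ∃ G : E →L[ℂ] E, G * (T + (ε : ℂ) • 1) = 1 ∧
      (T + (ε : ℂ) • 1) * G = 1 ∧ ‖(G ^ n) x‖ ≤ M) :
    ∃ y, (T ^ n) y = x ∧ ‖y‖ ≤ M := by
  -- Since `(T + ε)ⁿ` is symmetric and inverse to `Gⁿ`, `⟨x, z⟩ = ⟨Gⁿx, (T + ε)ⁿz⟩`. Apply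
  -- Cauchy–Schwarz and let `ε → 0`.
  have hbound : ∀ z, ‖inner ℂ x z‖ ≤ M * ‖(T ^ n) z‖ := by
    intro z
    have hlim : Filter.Tendsto (fun ε : ℝ => M * ‖((T + (ε : ℂ) • 1) ^ n) z‖)
        (nhdsWithin 0 (Ioi 0)) (nhds (M * ‖(T ^ n) z‖)) := by
      have hc : Continuous fun ε : ℝ => M * ‖((T + (ε : ℂ) • 1) ^ n) z‖ := by
        have : Continuous fun ε : ℝ => (T + (ε : ℂ) • (1 : E →L[ℂ] E)) ^ n := by fun_prop
        fun_prop
      have := hc.tendsto 0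
      simp only [Complex.ofReal_zero, zero_smul, add_zero] at this
      exact this.mono_left nhdsWithin_le_nhds
    refine ge_of_tendsto hlim ?_
    filter_upwards [Ioc_mem_nhdsGT (zero_lt_one' ℝ)] with ε hε
    obtain ⟨G, hG, hG', hb⟩ := h ε hε.1 hε.2
    have hsymm : ∀ a b, inner ℂ ((T + (ε : ℂ) • 1) a) b = inner ℂ a ((T + (ε : ℂ) • 1) b) := by
      intro a b
      simp [hT]
    have hx : ((T + (ε : ℂ) • 1) ^ n) ((G ^ n) x) = x := by
      rw [← mul_apply_eq_comp, ← (show Commute (T + (ε : ℂ) • 1) G from hG'.trans hG.symm).mul_pow,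
        hG', one_pow, one_apply_eq_self]
    calc ‖inner ℂ x z‖ = ‖inner ℂ ((G ^ n) x) (((T + (ε : ℂ) • 1) ^ n) z)‖ := by
          rw [← inner_pow_apply_left hsymm, hx]
      _ ≤ ‖(G ^ n) x‖ * ‖((T + (ε : ℂ) • 1) ^ n) z‖ := norm_inner_le_norm _ _
      _ ≤ M * ‖((T + (ε : ℂ) • 1) ^ n) z‖ := by gcongr
  have hinj' : Function.Injective ((T ^ n : E →L[ℂ] E) : E →ₗ[ℂ] E) := by
    clear h hbound
    induction n with
    | zero => exact fun a b hab => hab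
    | succ n ih =>
      rw [pow_succ']
      exact fun a b hab => ih (hinj hab)
  let e := LinearEquiv.ofInjective _ hinj'
  have he : ∀ p, (T ^ n) (e.symm p) = p := fun p =>
    congrArg Subtype.val (e.apply_symm_apply p)
  -- The functional `Tⁿz ↦ ⟨x, z⟩` on the range of `Tⁿ` is bounded by `M`. Its Hahn–Banach extension
  -- is represented by the required preimage `y`.
  let ℓ : StrongDual ℂ ((T ^ n : E →L[ℂ] E) : E →ₗ[ℂ] E).range :=
    LinearMap.mkContinuous ((innerSL ℂ x).toLinearMap ∘ₗ e.symm.toLinearMap) M fun p => by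
      have := hbound (e.symm p)
      rwa [he] at this
  obtain ⟨g, hg, hgn⟩ := exists_extension_norm_eq _ ℓ
  refine ⟨(InnerProductSpace.toDual ℂ E).symm g, ?_, ?_⟩
  · refine ext_inner_right ℂ fun z => ?_
    rw [inner_pow_apply_left hT, InnerProductSpace.toDual_symm_apply]
    have h1 := hg (e z)
    have h2 : ℓ (e z) = inner ℂ x (e.symm (e z)) := rfl
    rw [e.symm_apply_apply] at h2
    exact h1.trans h2
  · rw [LinearIsometryEquiv.norm_map, hgn]
    exact LinearMap.mkContinuous_norm_le _ hM _

theorem le_of_sq_le_mul {x p q r : ℝ} (hp : 0 ≤ p) (hq : 0 ≤ q) (hr : 0 ≤ r)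
    (h : x ^ 2 ≤ p * (r + q * x)) : x ≤ (q + 1) * p + r := by
  by_contra! hx
  have hxr : r < x := lt_of_le_of_lt (by nlinarith [mul_nonneg hq hp]) hx
  have hx0 : 0 < x := lt_of_le_of_lt hr hxr
  nlinarith [mul_lt_mul_of_pos_right hx hx0, mul_le_mul_of_nonneg_left hxr.le hp,
    mul_nonneg hr hx0.le]

/-- The constant of the intermediate derivative estimate. -/
def interpConst (K : ℝ) : ℝ := 6 * (K + 1) ^ 3

/-- The quadratic inequalities are solved from the top down: `a 3` in terms of `a 2, a 4`, then `a
2` in terms of `a 1, a 4`, then `a 1` in terms of `a 0, a 4`. Substituting back gives the constant.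
-/
theorem interpolation_bound {K : ℝ} (hK : 0 ≤ K) {a : ℕ → ℝ} (ha : ∀ k, 0 ≤ a k)
    (h : ∀ k < 3, a (k + 1) ^ 2 ≤ a k * (a (k + 2) + K * a (k + 1))) (k : ℕ) (hk : k < 3) :
    a (k + 1) ≤ interpConst K * (a 0 + a 4) := by
  have h0 := h 0 (by norm_num)
  have h1 := h 1 (by norm_num)
  have h2 := h 2 (by norm_num)
  norm_num at h0 h1 h2
  have e3 : a 3 ≤ (K + 1) * a 2 + a 4 := le_of_sq_le_mul (ha 2) hK (ha 4) h2
  have e2 : a 2 ≤ (2 * K + 1 + 1) * a 1 + a 4 := by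
    refine le_of_sq_le_mul (ha 1) (by positivity) (ha 4) (h1.trans ?_)
    exact mul_le_mul_of_nonneg_left (by linarith) (ha 1)
  have e1 : a 1 ≤ (3 * K + 2 + 1) * a 0 + a 4 := by
    refine le_of_sq_le_mul (ha 0) (by positivity) (ha 4) (h0.trans ?_)
    exact mul_le_mul_of_nonneg_left (by linarith) (ha 0)
  -- With `L = K + 1` the three bounds have leading coefficients `L`, `2L`, `3L`, whose product is
  -- `6L³`.
  obtain ⟨L, rfl⟩ : ∃ L, K = L - 1 := ⟨K + 1, by ring⟩
  have hL : 1 ≤ L := by linarith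
  have hL2 : L ≤ L ^ 2 := by nlinarith
  have hL3 : L ^ 2 ≤ L ^ 3 := by nlinarith [sq_nonneg L]
  have f2 : a 2 ≤ 6 * L ^ 2 * a 0 + 3 * L * a 4 := by
    have : (2 * (L - 1) + 1 + 1) * a 1 ≤
        2 * L * ((3 * (L - 1) + 2 + 1) * a 0 + a 4) := by
      have := mul_le_mul_of_nonneg_left e1 (show 0 ≤ 2 * L by linarith)
      linarith
    nlinarith [ha 4]
  have f3 : a 3 ≤ 6 * L ^ 3 * a 0 + 4 * L ^ 2 * a 4 := by
    have := mul_le_mul_of_nonneg_left f2 (show 0 ≤ L by linarith)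
    nlinarith [ha 4]
  have m1 := mul_le_mul_of_nonneg_right hL3 (ha 0)
  have m2 := mul_le_mul_of_nonneg_right hL3 (ha 4)
  have m3 := mul_le_mul_of_nonneg_right hL2 (ha 0)
  have m4 := mul_le_mul_of_nonneg_right hL2 (ha 4)
  have m5 := mul_le_mul_of_nonneg_right hL (ha 4)
  have m6 := mul_nonneg (show 0 ≤ L by linarith) (ha 0)
  unfold interpConst
  interval_cases k <;> norm_num <;> nlinarith [ha 0, ha 4]

/-- The energy estimate behind the intermediate derivative theorem, for a bounded operator `G`. -/
theorem energy_inequality {G : E →L[ℂ] E} (hG : ∀ x y, inner ℂ (G x) y = inner ℂ x (G y))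
    {c : ℝ} (hc : ∀ x, ‖x‖ ≤ c * ‖G x‖) {κ : ℝ} {u : ℕ → E} {k : ℕ} (hk : k < 3)
    (hu : ∀ n, inner ℂ (u (k + 1)) ((G ^ n) (u (k + 1))) + inner ℂ (u k) ((G ^ n) (u (k + 2))) =
      κ * inner ℂ (u k) ((G ^ n) (u (k + 1)))) :
    ‖(G ^ (4 - (k + 1))) (u (k + 1))‖ ^ 2 ≤ ‖(G ^ (4 - k)) (u k)‖ *
      (‖(G ^ (4 - (k + 2))) (u (k + 2))‖ + |κ| * c * ‖(G ^ (4 - (k + 1))) (u (k + 1))‖) := by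
  obtain ⟨m, hm0, hm1, hm2⟩ : ∃ m, 4 - (k + 2) = m ∧ 4 - (k + 1) = m + 1 ∧ 4 - k = m + 2 :=
    ⟨4 - (k + 2), rfl, by omega, by omega⟩
  rw [hm0, hm1, hm2]
  -- The power `2(m + 1)` is redistributed as `(m + 2) + m`, matching the powers of `G` in `a k` and
  -- `a (k+2)`.
  have hsplit : ∀ x y, inner ℂ x ((G ^ ((m + 1) + (m + 1))) y) =
      inner ℂ ((G ^ (m + 2)) x) ((G ^ m) y) := fun x y => by
    rw [inner_pow_apply_left hG, ← mul_apply_eq_comp, ← pow_add]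
    congr 3; omega
  have h1 : ((‖(G ^ (m + 1)) (u (k + 1))‖ ^ 2 : ℝ) : ℂ) =
      κ * inner ℂ ((G ^ (m + 2)) (u k)) ((G ^ m) (u (k + 1))) -
        inner ℂ ((G ^ (m + 2)) (u k)) ((G ^ m) (u (k + 2))) := by
    rw [← hsplit, ← hsplit, ← hu, add_sub_cancel_right, pow_add G (m + 1) (m + 1),
      mul_apply_eq_comp, ← inner_pow_apply_left hG, inner_self_eq_norm_sq_to_K]
    norm_cast
  have h2 := congrArg norm h1
  rw [Complex.norm_real, Real.norm_of_nonneg (sq_nonneg _)] at h2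
  rw [h2]
  -- The `κ` term carries one power of `G` fewer than `a (k+1)`; the lower bound on `G` supplies it.
  have h3 : ‖(G ^ m) (u (k + 1))‖ ≤ c * ‖(G ^ (m + 1)) (u (k + 1))‖ := by
    rw [pow_succ', mul_apply_eq_comp]; exact hc _
  refine (norm_sub_le _ _).trans ?_
  rw [norm_mul, Complex.norm_real, Real.norm_eq_abs]
  have h4 := norm_inner_le_norm (𝕜 := ℂ) ((G ^ (m + 2)) (u k)) ((G ^ m) (u (k + 1)))
  have h5 := norm_inner_le_norm (𝕜 := ℂ) ((G ^ (m + 2)) (u k)) ((G ^ m) (u (k + 2)))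
  have h6 := mul_le_mul_of_nonneg_left (h4.trans
    (mul_le_mul_of_nonneg_left h3 (norm_nonneg _))) (abs_nonneg κ)
  linarith

/-- Abstract form of the intermediate derivative theorem: `u 1, …, u 4` play the role of the
derivatives of `u 0 = T ^ 4 w`, where `T` is the inverse of the unbounded operator. -/
theorem exists_intermediate [CompleteSpace E] {T : E →L[ℂ] E}
    (hT : ∀ x y, inner ℂ (T x) y = inner ℂ x (T y)) (hT0 : ∀ x, 0 ≤ (inner ℂ (T x) x).re)
    (hinj : Function.Injective T) {κ : ℝ} {u : ℕ → E} {w : E} (hw : u 0 = (T ^ 4) w)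
    (hu : ∀ ε : ℝ, 0 < ε → ∃ G : E →L[ℂ] E, G * (T + (ε : ℂ) • 1) = 1 ∧
      (T + (ε : ℂ) • 1) * G = 1 ∧ ∀ k < 3, ∀ n,
        inner ℂ (u (k + 1)) ((G ^ n) (u (k + 1))) + inner ℂ (u k) ((G ^ n) (u (k + 2))) =
          κ * inner ℂ (u k) ((G ^ n) (u (k + 1)))) {k : ℕ} (hk : k < 3) :
    ∃ y, (T ^ (4 - (k + 1))) y = u (k + 1) ∧
      ‖y‖ ≤ interpConst (|κ| * (‖T‖ + 1)) * (‖w‖ + ‖u 4‖) := by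
  have hC : 0 ≤ interpConst (|κ| * (‖T‖ + 1)) := by unfold interpConst; positivity
  refine exists_preimage_of_resolvent_bound hT hinj _ _ (by positivity) fun ε hε hε1 => ?_
  obtain ⟨G, hG, hG', hGu⟩ := hu ε hε
  refine ⟨G, hG, hG', ?_⟩
  have := interpolation_bound (K := |κ| * (‖T‖ + 1)) (by positivity)
    (a := fun k => ‖(G ^ (4 - k)) (u k)‖) (fun k => norm_nonneg _)
    (fun k hk => energy_inequality (inner_resolvent_left hT hG')
      (norm_le_mul_norm_resolvent_apply hε.le hε1 hG') hk (hGu k hk)) k hk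
  refine this.trans (mul_le_mul_of_nonneg_left ?_ hC)
  simp only [hw, Nat.sub_zero, Nat.sub_self, pow_zero, one_apply_eq_self]
  gcongr
  exact norm_resolvent_pow_apply_le hT0 hε.le hG hG' 4 w

end Regularization

/-! ### Primitives of locally integrable functions and integration by parts. -/

section Primitives

variable {E F G : Type*} [NormedAddCommGroup E] [NormedSpace ℝ E]
  [NormedAddCommGroup F] [NormedSpace ℝ F] [NormedAddCommGroup G] [NormedSpace ℝ G]

/-- `g` is a primitive of the locally integrable function `g'`. -/
structure IsPrimitive (g g' : ℝ → F) : Prop where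
  intervalIntegrable : ∀ a b, IntervalIntegrable g' volume a b
  integral_eq : ∀ a b, ∫ t in a..b, g' t = g b - g a

theorem isPrimitive_integral {g' : ℝ → F} (h : ∀ a b, IntervalIntegrable g' volume a b) (c : F) :
    IsPrimitive (fun t => (∫ s in (0 : ℝ)..t, g' s) + c) g' :=
  ⟨h, fun a b => by
    rw [add_sub_add_right_eq_sub, intervalIntegral.integral_interval_sub_left (h 0 b) (h 0 a)]⟩

theorem IsPrimitive.continuous {g g' : ℝ → F} (h : IsPrimitive g g') : Continuous g := by
  have : g = fun t => (∫ s in (0 : ℝ)..t, g' s) + g 0 := by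
    ext t; rw [h.integral_eq, sub_add_cancel]
  rw [this]
  exact (intervalIntegral.continuous_primitive h.intervalIntegrable 0).add continuous_const

theorem IsPrimitive.hasDerivAt [CompleteSpace F] {g g' : ℝ → F} (h : IsPrimitive g g')
    (hg' : Continuous g') (t : ℝ) : HasDerivAt g (g' t) t := by
  have : g = fun t => (∫ s in (0 : ℝ)..t, g' s) + g 0 := by
    ext t; rw [h.integral_eq, sub_add_cancel]
  rw [this]
  exact (hg'.integral_hasStrictDerivAt 0 t).hasDerivAt.add_const _

theorem IsPrimitive.clm_comp [CompleteSpace F] [CompleteSpace G] {g g' : ℝ → F}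
    (h : IsPrimitive g g') (L : F →L[ℝ] G) :
    IsPrimitive (fun t => L (g t)) (fun t => L (g' t)) := by
  refine ⟨fun a b => ⟨L.integrable_comp (h.intervalIntegrable a b).1,
    L.integrable_comp (h.intervalIntegrable a b).2⟩, fun a b => ?_⟩
  rw [L.intervalIntegral_comp_comm (h.intervalIntegrable a b), h.integral_eq, map_sub]

/-- Integration by parts for a `C¹` function and a primitive of a locally integrable function. -/
theorem integral_bilin_by_parts [CompleteSpace E] [CompleteSpace F] [CompleteSpace G]
    (B : E →L[ℝ] F →L[ℝ] G)
    {f f' : ℝ → E} {g g' : ℝ → F} (hf : ∀ t, HasDerivAt f (f' t) t) (hf' : Continuous f')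
    (hg : IsPrimitive g g') {a b : ℝ} (hab : a ≤ b) :
    ∫ t in a..b, (B (f' t) (g t) + B (f t) (g' t)) = B (f b) (g b) - B (f a) (g a) := by
  have hfc : Continuous f := continuous_iff_continuousAt.mpr fun t => (hf t).continuousAt
  have hgc := hg.continuous
  have hfi : ∀ s, ∫ t in s..b, f' t = f b - f s := fun s =>
    intervalIntegral.integral_eq_sub_of_hasDerivAt (fun t _ => hf t) (hf'.intervalIntegrable _ _)
  have hi1 : IntervalIntegrable (fun t => B (f' t) (g t)) volume a b :=
    Continuous.intervalIntegrable (by fun_prop) _ _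
  have hig : Integrable g' (volume.restrict (Ioc a b)) := (hg.intervalIntegrable a b).1
  have hif : Integrable f' (volume.restrict (Ioc a b)) := (hf'.intervalIntegrable a b).1
  have hi2' : ∀ h : ℝ → E, Continuous h →
      IntervalIntegrable (fun t => B (h t) (g' t)) volume a b := by
    intro h hh
    rw [intervalIntegrable_iff_integrableOn_Ioc_of_le hab]
    obtain ⟨C, hC⟩ := (isCompact_Icc (a := a) (b := b)).exists_bound_of_continuousOn
      hh.continuousOn
    refine Integrable.mono' (hig.norm.const_mul (‖B‖ * C))
      (B.aestronglyMeasurable_comp₂ hh.aestronglyMeasurable hig.1) ?_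
    filter_upwards [ae_restrict_mem measurableSet_Ioc] with t ht
    refine (B.le_opNorm₂ _ _).trans ?_
    gcongr
    exact hC t (Ioc_subset_Icc_self ht)
  have hi2 := hi2' f hfc
  -- Both sides integrate `B (f' t) (g' s)` over the triangle `a < s ≤ t ≤ b`. Fubini replaces
  -- differentiation of `g`, which is only a primitive.
  have key : ∫ t in a..b, B (f' t) (g t - g a) = ∫ s in a..b, B (f b - f s) (g' s) := by
    set μ := volume.restrict (Ioc a b)
    let K : ℝ → ℝ → G := fun t s => if s ≤ t then B (f' t) (g' s) else 0
    have hK : Integrable (Function.uncurry K) (μ.prod μ) := by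
      have h1 : Integrable (fun z : ℝ × ℝ => B (f' z.1) (g' z.2)) (μ.prod μ) :=
        hif.op_fst_snd (by fun_prop) ⟨‖B‖, B.le_opNorm₂⟩ hig
      have h2 := h1.indicator (measurableSet_le measurable_snd measurable_fst)
      have h3 : Function.uncurry K = {a : ℝ × ℝ | a.2 ≤ a.1}.indicator
          fun z => B (f' z.1) (g' z.2) := by
        ext z; simp [K, Function.uncurry, indicator_apply]
      rw [h3]; exact h2
    have hl : ∫ t in a..b, B (f' t) (g t - g a) = ∫ t, ∫ s, K t s ∂μ ∂μ := by
      rw [intervalIntegral.integral_of_le hab]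
      refine setIntegral_congr_fun measurableSet_Ioc fun t ht => ?_
      have h3 : ∫ s, K t s ∂μ = ∫ s in Ioc a t, B (f' t) (g' s) := by
        have : (fun s => K t s) = (Iic t).indicator fun s => B (f' t) (g' s) := by
          ext s; simp [K, indicator_apply]
        rw [this, integral_indicator measurableSet_Iic, Measure.restrict_restrict measurableSet_Iic,
          inter_comm, Ioc_inter_Iic, min_eq_right ht.2]
      rw [h3, ← intervalIntegral.integral_of_le ht.1.le,
        (B (f' t)).intervalIntegral_comp_comm (hg.intervalIntegrable a t), hg.integral_eq]
    have hr : ∫ s in a..b, B (f b - f s) (g' s) = ∫ s, ∫ t, K t s ∂μ ∂μ := by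
      rw [intervalIntegral.integral_of_le hab]
      refine setIntegral_congr_fun measurableSet_Ioc fun s hs => ?_
      have h3 : ∫ t, K t s ∂μ = ∫ t in Icc s b, B (f' t) (g' s) := by
        have : (fun t => K t s) = (Ici s).indicator fun t => B (f' t) (g' s) := by
          ext t; simp [K, indicator_apply]
        rw [this, integral_indicator measurableSet_Ici, Measure.restrict_restrict measurableSet_Ici]
        congr 2
        ext t
        simp only [mem_inter_iff, mem_Ici, mem_Ioc, mem_Icc]
        exact ⟨fun h => ⟨h.1, h.2.2⟩, fun h => ⟨h.1, hs.1.trans_le h.1, h.2⟩⟩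
      rw [h3, integral_Icc_eq_integral_Ioc, ← intervalIntegral.integral_of_le hs.2]
      have := (B.flip (g' s)).intervalIntegral_comp_comm (hf'.intervalIntegrable (μ := volume) s b)
      simp only [ContinuousLinearMap.flip_apply] at this
      rw [this, hfi]
    rw [hl, hr, integral_integral_swap hK]
  have e1 : ∫ t in a..b, B (f' t) (g t - g a) =
      (∫ t in a..b, B (f' t) (g t)) - B (f b - f a) (g a) := by
    simp only [map_sub]
    rw [intervalIntegral.integral_sub hi1 (Continuous.intervalIntegrable (by fun_prop) _ _)]
    have := (B.flip (g a)).intervalIntegral_comp_comm (hf'.intervalIntegrable (μ := volume) a b)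
    simp only [ContinuousLinearMap.flip_apply] at this
    rw [this, hfi, map_sub]
  have e2 : ∫ s in a..b, B (f b - f s) (g' s) =
      B (f b) (g b - g a) - ∫ s in a..b, B (f s) (g' s) := by
    simp only [map_sub, sub_apply]
    rw [intervalIntegral.integral_sub (hi2' _ continuous_const) hi2,
      (B (f b)).intervalIntegral_comp_comm (hg.intervalIntegrable a b), hg.integral_eq, map_sub]
  rw [intervalIntegral.integral_add hi1 hi2]
  rw [e1, e2] at key
  rw [sub_eq_iff_eq_add] at key
  rw [key]
  simp only [map_sub, sub_apply]
  abel

end Primitives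

/-! ### Distributional derivatives as iterated primitives. -/

section WeakDerivatives

variable {H : Type*} [NormedAddCommGroup H] [InnerProductSpace ℂ H]

/-- Smooth compactly supported real functions on `(0, ∞)`. -/
structure IsTest (φ : ℝ → ℝ) : Prop where
  smooth : ContDiff ℝ ∞ φ
  compact : HasCompactSupport φ
  subset : tsupport φ ⊆ Ioi 0

theorem exists_Icc_of_isCompact_subset_Ioi {K : Set ℝ} (hK : IsCompact K) (h0 : K ⊆ Ioi 0) :
    ∃ a b, 0 < a ∧ a < b ∧ K ⊆ Icc a b := by
  rcases K.eq_empty_or_nonempty with rfl | hne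
  · exact ⟨1, 2, one_pos, one_lt_two, empty_subset _⟩
  · obtain ⟨a, ha⟩ := hK.exists_isLeast hne
    obtain ⟨b, hb⟩ := hK.exists_isGreatest hne
    have hab : a ≤ b := ha.2 hb.1
    exact ⟨a, b + 1, h0 ha.1, by linarith, fun x hx => ⟨ha.2 hx, by linarith [hb.2 hx]⟩⟩

theorem isTest_of_support_subset_Icc {φ : ℝ → ℝ} (hφ : ContDiff ℝ ∞ φ) {a b : ℝ} (ha : 0 < a)
    (h : ∀ t, t ∉ Icc a b → φ t = 0) : IsTest φ := by
  have hs : tsupport φ ⊆ Icc a b := closure_minimal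
    (fun t ht => by by_contra hc; exact ht (h t hc)) isClosed_Icc
  exact ⟨hφ, isCompact_Icc.of_isClosed_subset (isClosed_tsupport _) hs,
    hs.trans fun t ht => ha.trans_le ht.1⟩

theorem IsTest.exists_Ioo {φ : ℝ → ℝ} (hφ : IsTest φ) :
    ∃ a b, 0 < a ∧ a < b ∧ tsupport φ ⊆ Ioo a b := by
  obtain ⟨a, b, ha, hab, h⟩ := exists_Icc_of_isCompact_subset_Ioi hφ.compact hφ.subset
  refine ⟨a / 2, b + 1, by linarith, by linarith, fun t ht => ⟨?_, ?_⟩⟩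
  · linarith [(h ht).1]
  · linarith [(h ht).2]

theorem IsTest.sub_smul {φ ρ : ℝ → ℝ} (hφ : IsTest φ) (hρ : IsTest ρ) (m : ℝ) :
    IsTest (φ - m • ρ) := by
  obtain ⟨a, b, ha, -, h⟩ := hφ.exists_Ioo
  obtain ⟨a', b', ha', -, h'⟩ := hρ.exists_Ioo
  refine isTest_of_support_subset_Icc (a := min a a') (b := max b b')
    (hφ.smooth.sub (contDiff_const.smul hρ.smooth)) (lt_min ha ha') fun t ht => ?_
  have h1 : φ t = 0 := image_eq_zero_of_notMem_tsupport fun h1 =>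
    ht ⟨(min_le_left _ _).trans (h h1).1.le, (h h1).2.le.trans (le_max_left _ _)⟩
  have h2 : ρ t = 0 := image_eq_zero_of_notMem_tsupport fun h1 =>
    ht ⟨(min_le_right _ _).trans (h' h1).1.le, (h' h1).2.le.trans (le_max_right _ _)⟩
  simp [h1, h2]

theorem IsTest.integral_deriv_smul [CompleteSpace H] {φ : ℝ → ℝ} (hφ : IsTest φ) {V v : ℝ → H}
    (hV : IsPrimitive V v) : ∫ t, deriv φ t • V t = -∫ t, φ t • v t := by
  obtain ⟨a, b, ha, hab, hs⟩ := hφ.exists_Ioo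
  have h0 : ∀ t, t ∉ Ioo a b → φ t = 0 := fun t ht =>
    image_eq_zero_of_notMem_tsupport fun h1 => ht (hs h1)
  have hd : ∀ t, t ∉ Ioc a b → deriv φ t = 0 := fun t ht => by
    by_contra h1
    exact ht (Ioo_subset_Ioc_self (hs (support_deriv_subset h1)))
  have hc : Continuous (deriv φ) := hφ.smooth.continuous_deriv (by simp)
  have := integral_bilin_by_parts (ContinuousLinearMap.lsmul ℝ ℝ : ℝ →L[ℝ] H →L[ℝ] H)
    (fun t => (hφ.smooth.differentiable (by simp) t).hasDerivAt) hc hV hab.le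
  simp only [ContinuousLinearMap.lsmul_apply] at this
  rw [h0 b (fun h => lt_irrefl _ h.2), h0 a (fun h => lt_irrefl _ h.1), zero_smul, zero_smul,
    sub_zero, intervalIntegral.integral_add] at this
  · rw [intervalIntegral.integral_eq_integral_of_support_subset,
      intervalIntegral.integral_eq_integral_of_support_subset] at this
    · exact eq_neg_of_add_eq_zero_left this
    · intro t ht
      by_contra hc
      exact ht (by simp [h0 t fun h => hc (Ioo_subset_Ioc_self h)])
    · intro t ht
      by_contra hc
      exact ht (by simp [hd t hc])
  · exact (hc.smul hV.continuous).intervalIntegrable _ _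
  · exact (hV.intervalIntegrable a b).continuousOn_smul hφ.smooth.continuous.continuousOn

theorem exists_isTest_integral_eq_one : ∃ ρ : ℝ → ℝ, IsTest ρ ∧ ∫ t, ρ t = 1 := by
  let f : ContDiffBump (2 : ℝ) := ⟨1 / 2, 1, by norm_num, by norm_num⟩
  refine ⟨f.normed volume, ⟨f.contDiff_normed, f.hasCompactSupport_normed, ?_⟩, f.integral_normed⟩
  rw [f.tsupport_normed_eq]
  intro t ht
  rw [Metric.mem_closedBall, Real.dist_eq, abs_le] at ht
  have : f.rOut = 1 := rfl
  rw [mem_Ioi]; linarith [ht.1]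

/-- A test function of integral zero is the derivative of a test function. -/
theorem IsTest.exists_deriv_eq {ψ : ℝ → ℝ} (hψ : IsTest ψ) (h0 : ∫ t, ψ t = 0) :
    ∃ Ψ : ℝ → ℝ, IsTest Ψ ∧ deriv Ψ = ψ := by
  obtain ⟨a, b, ha, hab, hsub⟩ := hψ.exists_Ioo
  have hz : ∀ t, t ∉ Ioo a b → ψ t = 0 := fun t ht =>
    image_eq_zero_of_notMem_tsupport fun h1 => ht (hsub h1)
  have hc := hψ.smooth.continuous
  have hd : ∀ t, HasDerivAt (fun t => ∫ s in a..t, ψ s) (ψ t) t := fun t =>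
    (hc.integral_hasStrictDerivAt a t).hasDerivAt
  have hderiv : deriv (fun t => ∫ s in a..t, ψ s) = ψ := funext fun t => (hd t).deriv
  refine ⟨fun t => ∫ s in a..t, ψ s, ?_, hderiv⟩
  -- The primitive based at `a` vanishes to the left of `a` because `ψ` does, and to the right of
  -- `b` because `ψ` has integral zero.
  refine isTest_of_support_subset_Icc (a := a) (b := b) ?_ ha fun t ht => ?_
  · rw [contDiff_infty_iff_deriv, hderiv]
    exact ⟨fun t => (hd t).differentiableAt, hψ.smooth⟩
  · rw [mem_Icc, not_and_or, not_le, not_le] at ht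
    rcases ht with ht | ht
    · refine intervalIntegral.integral_zero_ae (ae_of_all _ fun s hs => hz s fun h => ?_)
      rw [uIoc_of_ge ht.le] at hs
      exact absurd hs.2 (not_le.mpr h.1)
    · rw [intervalIntegral.integral_eq_integral_of_support_subset, h0]
      intro s hs
      by_contra hc
      exact hs (hz s fun h => hc ⟨h.1, h.2.le.trans ht.le⟩)

/-- A function with a distributional derivative of order `k + 1` has one of order `k`, namely a
primitive of the former. -/
theorem HasWeakDeriv.exists_primitive [CompleteSpace H] {k : ℕ} {u v : ℝ → H}
    (h : HasWeakDeriv (k + 1) u v) (hv : ∀ a b, IntervalIntegrable v volume a b) :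
    ∃ V, IsPrimitive V v ∧ HasWeakDeriv k u V := by
  obtain ⟨ρ, hρ, hρ1⟩ := exists_isTest_integral_eq_one
  set V₀ : ℝ → H := fun t => (∫ s in (0 : ℝ)..t, v s) + 0
  have hV₀ : IsPrimitive V₀ v := isPrimitive_integral hv 0
  have hl : LocallyIntegrableOn V₀ (Ioi 0) :=
    hV₀.continuous.locallyIntegrable.locallyIntegrableOn _
  -- `Λ` measures the failure of `V₀` to be the derivative of order `k`. It kills test functions of
  -- integral zero, which are derivatives of test functions, so `Λ φ = (∫ φ) • Λ ρ`, and adding the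
  -- constant `c` to `V₀` corrects the defect.
  let Λ : (ℝ → ℝ) → H := fun φ =>
    (∫ t, iteratedDeriv k φ t • u t) - (-1 : ℝ) ^ k • ∫ t, φ t • V₀ t
  let c : H := (-1 : ℝ) ^ k • Λ ρ
  have hc : IsPrimitive (fun t => V₀ t + c) v := by
    simpa only [V₀, add_zero] using isPrimitive_integral hv c
  refine ⟨_, hc, h.left, hc.continuous.locallyIntegrable.locallyIntegrableOn _,
    fun φ hφ hcs hs => ?_⟩
  have hφt : IsTest φ := ⟨hφ, hcs, hs⟩
  set m := ∫ t, φ t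
  have hψ : IsTest (φ - m • ρ) := hφt.sub_smul hρ m
  have hφi : Integrable φ := hφ.continuous.integrable_of_hasCompactSupport hcs
  have hρi : Integrable ρ := hρ.smooth.continuous.integrable_of_hasCompactSupport hρ.compact
  have hψ0 : ∫ t, (φ - m • ρ) t = 0 := by
    simp only [Pi.sub_apply, Pi.smul_apply]
    have hmρ : Integrable fun t => m • ρ t := hρi.smul m
    rw [integral_sub hφi hmρ, integral_smul, hρ1]
    simp [m]
  obtain ⟨Ψ, hΨ, hΨd⟩ := hψ.exists_deriv_eq hψ0
  have hΛ0 : Λ (φ - m • ρ) = 0 := by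
    have h1 := h.eq Ψ hΨ.smooth hΨ.compact hΨ.subset
    have h2 := hΨ.integral_deriv_smul hV₀
    rw [iteratedDeriv_succ', hΨd] at h1
    rw [hΨd] at h2
    simp only [Λ]
    rw [h1, h2, pow_succ]
    simp
  have hΛ : Λ (φ - m • ρ) = Λ φ - m • Λ ρ := by
    have e1 : ∀ t, iteratedDeriv k (φ - m • ρ) t =
        iteratedDeriv k φ t - m • iteratedDeriv k ρ t := fun t => by
      have c1 : ContDiffAt ℝ k φ t := (hφ.of_le (by exact_mod_cast le_top)).contDiffAt
      have c2 : ContDiffAt ℝ k ρ t := (hρ.smooth.of_le (by exact_mod_cast le_top)).contDiffAt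
      rw [iteratedDeriv_sub c1 (show ContDiffAt ℝ k (m • ρ) t from c2.const_smul m),
        iteratedDeriv_const_smul c2]
    simp only [Λ, e1, Pi.sub_apply, Pi.smul_apply, sub_smul, smul_assoc]
    have i1 : Integrable fun t => m • iteratedDeriv k ρ t • u t :=
      (integrable_iteratedDeriv_smul h.left k hρ.smooth hρ.compact hρ.subset).smul m
    have i2 : Integrable fun t => m • ρ t • V₀ t :=
      (integrable_test_smul hl hρ.smooth.continuous hρ.compact hρ.subset).smul m
    rw [integral_sub (integrable_iteratedDeriv_smul h.left k hφ hcs hs) i1,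
      integral_sub (integrable_test_smul hl hφ.continuous hcs hs) i2,
      integral_smul, integral_smul, smul_sub, smul_sub, smul_comm m ((-1 : ℝ) ^ k)]
    abel
  have hΛφ : Λ φ = m • Λ ρ := by rw [hΛ0] at hΛ; exact (sub_eq_zero.mp hΛ.symm)
  simp only [smul_add]
  rw [integral_add (integrable_test_smul hl hφ.continuous hcs hs) (hφi.smul_const c),
    integral_smul_const, smul_add, ← sub_eq_iff_eq_add']
  change Λ φ = _
  rw [hΛφ]
  simp only [c]
  rw [smul_comm ((-1 : ℝ) ^ k) (∫ t, φ t), smul_smul ((-1 : ℝ) ^ k), ← mul_pow]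
  simp [m]

/-- A function whose distributional derivative of order `n` is a locally integrable function on
`[0, ∞)` has distributional derivatives of all lower orders, each of them a primitive of the
next. -/
theorem HasWeakDeriv.exists_derivatives [CompleteSpace H] {n : ℕ} {u v : ℝ → H}
    (h : HasWeakDeriv n u v) (hv : ∀ a b, IntervalIntegrable v volume a b) :
    ∃ d : ℕ → ℝ → H, d n = v ∧ (∀ k < n, IsPrimitive (d k) (d (k + 1))) ∧
      ∀ k ≤ n, HasWeakDeriv k u (d k) := by
  induction n generalizing v with
  | zero => exact ⟨fun _ => v, rfl, by simp, fun k hk => by rwa [Nat.le_zero.mp hk]⟩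
  | succ n ih =>
    obtain ⟨V, hV, hVu⟩ := h.exists_primitive hv
    obtain ⟨d, hd, hp, hw⟩ := ih hVu fun a b => hV.continuous.intervalIntegrable a b
    refine ⟨Function.update d (n + 1) v, by simp, fun k hk => ?_, fun k hk => ?_⟩
    · rw [Function.update_of_ne (by omega)]
      rcases Nat.lt_succ_iff_lt_or_eq.mp hk with hk' | rfl
      · rw [Function.update_of_ne (by omega)]; exact hp k hk'
      · rw [Function.update_self, hd]; exact hV
    · rcases Nat.le_succ_iff.mp hk with hk' | rfl
      · rw [Function.update_of_ne (by omega)]; exact hw k hk'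
      · rwa [Function.update_self]

end WeakDerivatives

/-! ### Weighted estimates: intermediate derivatives lie in `L_{2,κ}`. -/

section Weighted

open scoped ENNReal

variable {H : Type*} [NormedAddCommGroup H] [InnerProductSpace ℂ H]

theorem lintegral_weightedMeasure (κ : ℝ) {f : ℝ → ℝ≥0∞} (hf : Measurable f) :
    ∫⁻ t, f t ∂(weightedMeasure κ) =
      ∫⁻ t in Ici 0, ENNReal.ofReal (Real.exp (-κ * t)) * f t := by
  rw [weightedMeasure, lintegral_withDensity_eq_lintegral_mul _ (by fun_prop) hf]
  rfl

theorem ofReal_exp_le (κ : ℝ) {s t R : ℝ} (h : |s - t| ≤ R) :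
    ENNReal.ofReal (Real.exp (-κ * t)) ≤
      ENNReal.ofReal (Real.exp (|κ| * R)) * ENNReal.ofReal (Real.exp (-κ * s)) := by
  rw [← ENNReal.ofReal_mul (Real.exp_pos _).le, ← Real.exp_add]
  refine ENNReal.ofReal_le_ofReal (Real.exp_le_exp.mpr ?_)
  have h1 : κ * (s - t) ≤ |κ| * R :=
    (le_abs_self _).trans (by rw [abs_mul]; gcongr)
  linarith

theorem restrict_Ioc_le_weightedMeasure (κ R : ℝ) :
    volume.restrict (Ioc 0 R) ≤ ENNReal.ofReal (Real.exp (|κ| * R)) • weightedMeasure κ := by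
  refine Measure.le_iff.mpr fun s hs => ?_
  rw [Measure.smul_apply, weightedMeasure, withDensity_apply _ hs, Measure.restrict_restrict hs,
    Measure.restrict_apply hs, smul_eq_mul, ← lintegral_const_mul _ (by fun_prop)]
  calc volume (s ∩ Ioc 0 R) = ∫⁻ _ in s ∩ Ioc 0 R, 1 := by simp
    _ ≤ ∫⁻ t in s ∩ Ioc 0 R, ENNReal.ofReal (Real.exp (|κ| * R)) *
        ENNReal.ofReal (Real.exp (-κ * t)) := by
      refine setLIntegral_mono' (hs.inter measurableSet_Ioc) fun t ht => ?_
      have := ofReal_exp_le κ (s := t) (t := 0) (R := R)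
        (by rw [sub_zero, abs_of_pos ht.2.1]; exact ht.2.2)
      simpa using this
    _ ≤ _ := lintegral_mono_set (inter_subset_inter_right _ fun t ht => ht.1.le)

/-- The weight is bounded below on `(0, R]`, so functions in `L_{2,κ}` are integrable up to the
endpoint `0`. The indicator removes the arbitrary values off `(0, ∞)`. -/
theorem intervalIntegrable_indicator_of_memLp {E : Type*} [NormedAddCommGroup E] {κ : ℝ}
    {f : ℝ → E}
    (hf : MemLp f 2 (weightedMeasure κ)) (a b : ℝ) :
    IntervalIntegrable ((Ioi 0).indicator f) volume a b := by
  have h1 : ∀ R, IntegrableOn f (Ioc 0 R) := fun R =>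
    (hf.of_measure_le_smul ENNReal.ofReal_ne_top
      (restrict_Ioc_le_weightedMeasure κ R)).integrable (by norm_num)
  rw [intervalIntegrable_iff, IntegrableOn, integrable_indicator_iff measurableSet_Ioi,
    IntegrableOn, Measure.restrict_restrict measurableSet_Ioi]
  exact (h1 (max a b)).mono_set fun t ht => ⟨ht.1, ht.2.2⟩

/-- Tonelli on the strip `t < s ≤ t + 1`: each `s` is met by `t` in an interval of length one, on
which the weight at `t` is at most `e^{|κ|}` times the weight at `s`. -/
theorem lintegral_lintegral_Ioc_le (κ : ℝ) {f : ℝ → ℝ≥0∞} (hf : Measurable f) :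
    ∫⁻ t, (∫⁻ s in Ioc t (t + 1), f s) ∂(weightedMeasure κ) ≤
      ENNReal.ofReal (Real.exp |κ|) * ∫⁻ s, f s ∂(weightedMeasure κ) := by
  set c := ENNReal.ofReal (Real.exp |κ|)
  set w : ℝ → ℝ≥0∞ := fun t => ENNReal.ofReal (Real.exp (-κ * t))
  have hwm : Measurable w := by fun_prop
  let D : Set (ℝ × ℝ) := {p | p.1 < p.2 ∧ p.2 ≤ p.1 + 1}
  have hD : MeasurableSet D := (measurableSet_lt measurable_fst measurable_snd).inter
    (measurableSet_le measurable_snd (measurable_fst.add_const 1))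
  have hin : ∀ t, ∫⁻ s in Ioc t (t + 1), f s = ∫⁻ s, D.indicator (fun p => f p.2) (t, s) := by
    intro t
    rw [← lintegral_indicator measurableSet_Ioc]
    rfl
  have hDf : Measurable (D.indicator fun p => f p.2) := (hf.comp measurable_snd).indicator hD
  have hm : Measurable fun t => ∫⁻ s in Ioc t (t + 1), f s := by
    simp_rw [hin]
    exact hDf.lintegral_prod_right'
  let g : ℝ → ℝ≥0∞ := (Ici 0).indicator fun s => c * (w s * f s)
  have hg : Measurable g := by fun_prop (disch := exact measurableSet_Ici)
  have hDg : Measurable (D.indicator fun p => g p.2) := (hg.comp measurable_snd).indicator hD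
  rw [lintegral_weightedMeasure κ hm, lintegral_weightedMeasure κ hf,
    ← lintegral_const_mul _ (by fun_prop)]
  calc ∫⁻ t in Ici 0, w t * ∫⁻ s in Ioc t (t + 1), f s
      ≤ ∫⁻ t in Ici 0, ∫⁻ s, D.indicator (fun p => g p.2) (t, s) := by
        refine setLIntegral_mono' measurableSet_Ici fun t ht => ?_
        rw [hin, ← lintegral_const_mul' _ _ ENNReal.ofReal_ne_top]
        refine lintegral_mono fun s => ?_
        by_cases hs : (t, s) ∈ D
        · have hs0 : s ∈ Ici (0 : ℝ) := (mem_Ici.mp ht).trans hs.1.le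
          simp only [indicator_of_mem hs, g, indicator_of_mem hs0]
          rw [← mul_assoc]
          gcongr
          have := ofReal_exp_le κ (s := s) (t := t) (R := 1)
            (by rw [abs_of_pos (sub_pos.mpr hs.1)]; linarith [hs.2])
          simpa [c, w] using this
        · simp [indicator_of_notMem hs]
    _ ≤ ∫⁻ t, ∫⁻ s, D.indicator (fun p => g p.2) (t, s) := setLIntegral_le_lintegral _ _
    _ = ∫⁻ s, ∫⁻ t, D.indicator (fun p => g p.2) (t, s) :=
        lintegral_lintegral_swap (f := fun t s => D.indicator (fun p => g p.2) (t, s))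
          hDg.aemeasurable
    _ = ∫⁻ s, g s := by
        congr 1 with s
        have : ∀ t, D.indicator (fun p => g p.2) (t, s) =
            (Ico (s - 1) s).indicator (fun _ => g s) t := fun t => by
          have : (t, s) ∈ D ↔ t ∈ Ico (s - 1) s :=
            ⟨fun h => ⟨by linarith [h.2], h.1⟩, fun h => ⟨h.2, by linarith [h.1]⟩⟩
          simp only [indicator_apply, this]
        simp_rw [this]
        rw [lintegral_indicator measurableSet_Ico]
        simp
    _ = ∫⁻ s in Ici 0, c * (w s * f s) := lintegral_indicator measurableSet_Ici _

theorem memLp_two_iff_lintegral {E : Type*} [NormedAddCommGroup E] {μ : Measure ℝ} {f : ℝ → E} :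
    MemLp f 2 μ ↔ AEStronglyMeasurable f μ ∧ ∫⁻ t, ‖f t‖ₑ ^ 2 ∂μ < ⊤ := by
  rw [MemLp, eLpNorm_lt_top_iff_lintegral_rpow_enorm_lt_top two_ne_zero ENNReal.ofNat_ne_top]
  simp

theorem sq_lintegral_Ioc_le {f : ℝ → ℝ≥0∞} (hf : Measurable f) (t : ℝ) :
    (∫⁻ s in Ioc t (t + 1), f s) ^ 2 ≤ ∫⁻ s in Ioc t (t + 1), f s ^ 2 := by
  have := ENNReal.lintegral_mul_le_Lp_mul_Lq (volume.restrict (Ioc t (t + 1)))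
    Real.HolderConjugate.two_two hf.aemeasurable (aemeasurable_const (b := (1 : ℝ≥0∞)))
  simp only [Pi.mul_apply, mul_one, ENNReal.one_rpow, lintegral_const, Measure.restrict_apply_univ,
    Real.volume_Ioc, add_sub_cancel_left, ENNReal.ofReal_one] at this
  calc _ ≤ ((∫⁻ s in Ioc t (t + 1), f s ^ (2 : ℝ)) ^ (1 / 2 : ℝ)) ^ 2 := by gcongr
    _ = _ := by
      rw [← ENNReal.rpow_natCast, ← ENNReal.rpow_mul]
      norm_num

/-- A function dominated by a moving average of a function in `L_{2,κ}` lies in `L_{2,κ}`. -/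
theorem memLp_of_le_lintegral_Ioc {E : Type*} [NormedAddCommGroup E] {κ : ℝ} {g : ℝ → E}
    {h : ℝ → ℝ} (hg : Continuous g)
    (hh : Measurable h) (hhL : MemLp h 2 (weightedMeasure κ)) {M : ℝ≥0∞} (hM : M ≠ ⊤)
    (hgh : ∀ t, 0 < t → ‖g t‖ₑ ≤ M * ∫⁻ s in Ioc t (t + 1), ‖h s‖ₑ) :
    MemLp g 2 (weightedMeasure κ) := by
  rw [memLp_two_iff_lintegral] at hhL ⊢
  refine ⟨hg.aestronglyMeasurable, ?_⟩
  have hm : Measurable fun s => ‖h s‖ₑ ^ 2 := by fun_prop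
  calc ∫⁻ t, ‖g t‖ₑ ^ 2 ∂(weightedMeasure κ)
      ≤ ∫⁻ t, M ^ 2 * (∫⁻ s in Ioc t (t + 1), ‖h s‖ₑ ^ 2) ∂(weightedMeasure κ) := by
        refine lintegral_mono_ae ?_
        rw [ae_weightedMeasure]
        filter_upwards [ae_restrict_mem measurableSet_Ioi] with t ht
        calc ‖g t‖ₑ ^ 2 ≤ (M * ∫⁻ s in Ioc t (t + 1), ‖h s‖ₑ) ^ 2 := by
              gcongr; exact hgh t ht
          _ ≤ _ := by
              rw [mul_pow]
              gcongr
              exact sq_lintegral_Ioc_le (by fun_prop) t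
    _ = M ^ 2 * ∫⁻ t, (∫⁻ s in Ioc t (t + 1), ‖h s‖ₑ ^ 2) ∂(weightedMeasure κ) :=
        lintegral_const_mul' _ _ (ENNReal.pow_ne_top hM)
    _ ≤ M ^ 2 * (ENNReal.ofReal (Real.exp |κ|) * ∫⁻ s, ‖h s‖ₑ ^ 2 ∂(weightedMeasure κ)) := by
        gcongr; exact lintegral_lintegral_Ioc_le κ hm
    _ < ⊤ := ENNReal.mul_lt_top (ENNReal.pow_lt_top hM.lt_top)
        (ENNReal.mul_lt_top ENNReal.ofReal_lt_top hhL.2)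

/-- Keeping the support of `χ'` strictly inside `(0, 1)` makes its translates by `t > 0` test
functions on `(0, ∞)`. -/
theorem exists_cutoff : ∃ χ : ℝ → ℝ, ContDiff ℝ ∞ χ ∧ χ 0 = 1 ∧ χ 1 = 0 ∧ (∀ s, ‖χ s‖ ≤ 1) ∧
    tsupport (deriv χ) ⊆ Icc (1 / 3) (2 / 3) := by
  refine ⟨fun s => Real.smoothTransition (2 - 3 * s), ?_, ?_, ?_, fun s => ?_, ?_⟩
  · exact Real.smoothTransition.contDiff.comp (contDiff_const.sub (contDiff_const.mul contDiff_id))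
  · exact Real.smoothTransition.one_of_one_le (by norm_num)
  · exact Real.smoothTransition.zero_of_nonpos (by norm_num)
  · rw [Real.norm_of_nonneg (Real.smoothTransition.nonneg _)]
    exact Real.smoothTransition.le_one _
  · refine closure_minimal (fun s hs => ?_) isClosed_Icc
    by_contra hc
    rw [mem_Icc, not_and_or, not_le, not_le] at hc
    apply hs
    rcases hc with hc | hc
    · have : (fun s : ℝ => Real.smoothTransition (2 - 3 * s)) =ᶠ[nhds s] fun _ => (1 : ℝ) := by
        filter_upwards [Iio_mem_nhds hc] with x hx
        exact Real.smoothTransition.one_of_one_le (by rw [mem_Iio] at hx; linarith)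
      rw [this.deriv_eq, deriv_const]
    · have : (fun s : ℝ => Real.smoothTransition (2 - 3 * s)) =ᶠ[nhds s] fun _ => (0 : ℝ) := by
        filter_upwards [Ioi_mem_nhds hc] with x hx
        exact Real.smoothTransition.zero_of_nonpos (by rw [mem_Ioi] at hx; linarith)
      rw [this.deriv_eq, deriv_const]

/-- Local estimate of a derivative by the next one and by the function itself. -/
theorem exists_enorm_le_lintegral_Ioc [CompleteSpace H] (k : ℕ) :
    ∃ M : ℝ≥0∞, M ≠ ⊤ ∧ ∀ u d d' : ℝ → H, HasWeakDeriv k u d → IsPrimitive d d' →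
      ∀ t, 0 < t → ‖d t‖ₑ ≤ M * ∫⁻ s in Ioc t (t + 1), ‖‖d' s‖ + ‖u s‖‖ₑ := by
  obtain ⟨χ, hχ, h0, h1, hb, hs⟩ := exists_cutoff
  have hχ' : ContDiff ℝ ∞ (deriv χ) := (contDiff_infty_iff_deriv.mp hχ).2
  have hit : ∀ s, s ∉ Icc (1 / 3 : ℝ) (2 / 3) → iteratedDeriv k (deriv χ) s = 0 := fun s hsn => by
    by_contra h
    refine hsn (hs (support_iteratedFDeriv_subset (𝕜 := ℝ) k ?_))
    intro h2
    exact h (by simp [iteratedDeriv, h2])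
  have hitc : Continuous (iteratedDeriv k (deriv χ)) :=
    hχ'.continuous_iteratedDeriv k (by exact_mod_cast le_top)
  obtain ⟨M, hM⟩ := (isCompact_Icc (a := (1 / 3 : ℝ)) (b := 2 / 3)).exists_bound_of_continuousOn
    hitc.continuousOn
  have hM' : ∀ s, ‖iteratedDeriv k (deriv χ) s‖ ≤ max M 1 := fun s => by
    by_cases h : s ∈ Icc (1 / 3 : ℝ) (2 / 3)
    · exact (hM s h).trans (le_max_left _ _)
    · rw [hit s h, norm_zero]; positivity
  refine ⟨ENNReal.ofReal (max M 1), ENNReal.ofReal_ne_top, fun u d d' hu hd t ht => ?_⟩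
  -- As `χ(0) = 1` and `χ(1) = 0`, this reads `d(t) = -∫ χ'(s-t) d(s) - ∫ χ(s-t) d'(s)` over `[t,
  -- t+1]`. In the first integral the `k` derivatives hidden in `d` are then moved onto `χ'`,
  -- leaving only `u`.
  have hparts := integral_bilin_by_parts (ContinuousLinearMap.lsmul ℝ ℝ : ℝ →L[ℝ] H →L[ℝ] H)
    (f := fun s => χ (s - t)) (f' := fun s => deriv χ (s - t))
    (fun s => ((hχ.differentiable (by simp) _).hasDerivAt.comp_sub_const s t))
    (hχ'.continuous.comp (continuous_sub_right t)) hd (show t ≤ t + 1 by linarith)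
  simp only [ContinuousLinearMap.lsmul_apply, add_sub_cancel_left, sub_self, h0, h1, zero_smul,
    one_smul, zero_sub] at hparts
  rw [intervalIntegral.integral_add] at hparts
  rotate_left
  · exact ((hχ'.continuous.comp (continuous_sub_right t)).smul hd.continuous).intervalIntegrable _ _
  · exact (hd.intervalIntegrable _ _).continuousOn_smul
      (hχ.continuous.comp (continuous_sub_right t)).continuousOn
  have hI : ∀ s, s - t ∈ Icc (1 / 3 : ℝ) (2 / 3) → s ∈ Ioc t (t + 1) := fun s h =>
    ⟨by linarith [h.1], by linarith [h.2]⟩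
  have e1 : ∫ s in t..t + 1, deriv χ (s - t) • d s = ∫ s, deriv χ (s - t) • d s := by
    refine intervalIntegral.integral_eq_integral_of_support_subset fun s h => ?_
    refine hI s (hs (subset_tsupport _ fun h2 => h ?_))
    simp [h2]
  have htest : IsTest fun s => deriv χ (s - t) := by
    refine isTest_of_support_subset_Icc (a := t + 1 / 3) (b := t + 2 / 3)
      (hχ'.comp (contDiff_id.sub contDiff_const)) (by linarith) fun s h => ?_
    by_contra h2
    have := hs (subset_tsupport _ h2)
    exact h ⟨by linarith [this.1], by linarith [this.2]⟩
  have e2 := hu.eq _ htest.smooth htest.compact htest.subset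
  rw [iteratedDeriv_comp_sub_const] at e2
  have e3 : ‖∫ s, deriv χ (s - t) • d s‖ₑ =
      ‖∫ s in Ioc t (t + 1), iteratedDeriv k (deriv χ) (s - t) • u s‖ₑ := by
    have e4 : ∫ s in Ioc t (t + 1), iteratedDeriv k (deriv χ) (s - t) • u s =
        ∫ s, iteratedDeriv k (deriv χ) (s - t) • u s := by
      refine setIntegral_eq_integral_of_forall_compl_eq_zero fun s h => ?_
      rw [hit _ fun h2 => h (hI s h2), zero_smul]
    rw [e4, e2, enorm_smul]
    simp
  have e5 : d t = -((∫ s in t..t + 1, deriv χ (s - t) • d s) +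
      ∫ s in t..t + 1, χ (s - t) • d' s) := by rw [hparts, neg_neg]
  rw [e5, enorm_neg]
  refine (enorm_add_le _ _).trans ?_
  rw [e1, e3, intervalIntegral.integral_of_le (by linarith)]
  have hmeas : AEMeasurable (fun s => ENNReal.ofReal (max M 1) * ‖d' s‖ₑ)
      (volume.restrict (Ioc t (t + 1))) :=
    (hd.intervalIntegrable t (t + 1)).1.1.enorm.const_mul _
  calc _ ≤ (∫⁻ s in Ioc t (t + 1), ENNReal.ofReal (max M 1) * ‖u s‖ₑ) +
        ∫⁻ s in Ioc t (t + 1), ENNReal.ofReal (max M 1) * ‖d' s‖ₑ := by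
        gcongr
        · refine (enorm_integral_le_lintegral_enorm _).trans (lintegral_mono fun s => ?_)
          rw [enorm_smul, ← ofReal_norm]
          gcongr
          exact hM' _
        · refine (enorm_integral_le_lintegral_enorm _).trans (lintegral_mono fun s => ?_)
          rw [enorm_smul, ← ofReal_norm]
          gcongr
          exact (hb _).trans (le_max_right _ _)
    _ = ∫⁻ s in Ioc t (t + 1), ENNReal.ofReal (max M 1) * ‖‖d' s‖ + ‖u s‖‖ₑ := by
        rw [← lintegral_add_right' _ hmeas]
        congr 1 with s
        rw [← mul_add, Real.enorm_of_nonneg (by positivity), ENNReal.ofReal_add (norm_nonneg _)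
          (norm_nonneg _), ofReal_norm, ofReal_norm, add_comm]
    _ = _ := lintegral_const_mul' _ _ ENNReal.ofReal_ne_top

/-- The intermediate derivatives of a function in `L_{2,κ}` with derivative of order `n` in
`L_{2,κ}` lie in `L_{2,κ}`. -/
theorem memLp_derivatives [CompleteSpace H] {κ : ℝ} {n : ℕ} {u : ℝ → H} {d : ℕ → ℝ → H}
    (hum : StronglyMeasurable u) (hu : MemLp u 2 (weightedMeasure κ))
    (hdm : StronglyMeasurable (d n)) (hdn : MemLp (d n) 2 (weightedMeasure κ))
    (hp : ∀ k < n, IsPrimitive (d k) (d (k + 1))) (hw : ∀ k ≤ n, HasWeakDeriv k u (d k))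
    {k : ℕ} (hk : k ≤ n) : MemLp (d k) 2 (weightedMeasure κ) := by
  have hm : ∀ k ≤ n, StronglyMeasurable (d k) := fun k hk => by
    rcases hk.lt_or_eq with h | rfl
    · exact (hp k h).continuous.stronglyMeasurable
    · exact hdm
  induction hk using Nat.decreasingInduction with
  | self => exact hdn
  | of_succ k hk ih =>
    obtain ⟨M, hM, h⟩ := exists_enorm_le_lintegral_Ioc (H := H) k
    exact memLp_of_le_lintegral_Ioc (hp k hk).continuous
      (((hm (k + 1) hk).norm.add hum.norm).measurable) (ih.norm.add hu.norm) hM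
      (h u (d k) (d (k + 1)) (hw k hk.le) (hp k hk))

end Weighted

/-! ### Integration by parts in the weighted space. -/

section EnergyIdentity

variable {H : Type*} [NormedAddCommGroup H] [InnerProductSpace ℂ H]

theorem integrable_weightedMeasure_iff {E : Type*} [NormedAddCommGroup E] [NormedSpace ℝ E]
    (κ : ℝ) {h : ℝ → E} :
    Integrable h (weightedMeasure κ) ↔ IntegrableOn (fun t => Real.exp (-κ * t) • h t) (Ioi 0) := by
  rw [weightedMeasure, integrable_withDensity_iff_integrable_smul' (by fun_prop)
    (ae_of_all _ fun t => ENNReal.ofReal_lt_top), IntegrableOn, restrict_Ioi_eq_restrict_Ici]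
  simp_rw [ENNReal.toReal_ofReal (Real.exp_pos _).le]

theorem integral_weightedMeasure {E : Type*} [NormedAddCommGroup E] [NormedSpace ℝ E]
    (κ : ℝ) (h : ℝ → E) :
    ∫ t, h t ∂(weightedMeasure κ) = ∫ t in Ioi 0, Real.exp (-κ * t) • h t := by
  rw [weightedMeasure, integral_withDensity_eq_integral_toReal_smul (by fun_prop)
    (ae_of_all _ fun t => ENNReal.ofReal_lt_top), restrict_Ioi_eq_restrict_Ici]
  simp_rw [ENNReal.toReal_ofReal (Real.exp_pos _).le]

theorem integrable_inner_of_memLp {α : Type*} [MeasurableSpace α] {μ : Measure α} {f g : α → H}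
    (hf : MemLp f 2 μ) (hg : MemLp g 2 μ) : Integrable (fun t => inner ℂ (f t) (g t)) μ := by
  refine (L2.integrable_inner (𝕜 := ℂ) (hf.toLp f) (hg.toLp g)).congr ?_
  filter_upwards [hf.coeFn_toLp, hg.coeFn_toLp] with t h1 h2
  rw [h1, h2]

theorem inner_toLp {α : Type*} [MeasurableSpace α] {μ : Measure α} {f g : α → H}
    (hf : MemLp f 2 μ) (hg : MemLp g 2 μ) :
    inner ℂ (hf.toLp f) (hg.toLp g) = ∫ t, inner ℂ (f t) (g t) ∂μ := by
  rw [L2.inner_def]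
  refine integral_congr_ae ?_
  filter_upwards [hf.coeFn_toLp, hg.coeFn_toLp] with t h1 h2
  rw [h1, h2]

/-- Integration by parts in `L_{2,κ}`: the derivative, taken on functions vanishing at `0`, and
`κ` minus the derivative are formally adjoint to each other. -/
theorem integral_inner_deriv_add [CompleteSpace H] {κ : ℝ} {f f' g g' : ℝ → H}
    (hf : ∀ t, HasDerivAt f (f' t) t) (hf' : Continuous f') (hf0 : f 0 = 0)
    (hg : IsPrimitive g g') (mf : MemLp f 2 (weightedMeasure κ))
    (mf' : MemLp f' 2 (weightedMeasure κ)) (mg : MemLp g 2 (weightedMeasure κ))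
    (mg' : MemLp g' 2 (weightedMeasure κ)) :
    ∫ t, inner ℂ (f' t) (g t) ∂(weightedMeasure κ) +
      ∫ t, inner ℂ (f t) (g' t) ∂(weightedMeasure κ) =
      κ * ∫ t, inner ℂ (f t) (g t) ∂(weightedMeasure κ) := by
  have i1 := integrable_inner_of_memLp mf' mg
  have i2 := integrable_inner_of_memLp mf mg'
  have i3 := integrable_inner_of_memLp mf mg
  -- `e^{-κt} J(t)` is the derivative of `e^{-κt} ⟨f, g⟩`.
  let J : ℝ → ℂ := fun t =>
    inner ℂ (f' t) (g t) + inner ℂ (f t) (g' t) - κ * inner ℂ (f t) (g t)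
  have iJ : Integrable J (weightedMeasure κ) := (i1.add i2).sub (i3.const_mul _)
  have hJ : ∫ t, J t ∂(weightedMeasure κ) = ∫ t, inner ℂ (f' t) (g t) ∂(weightedMeasure κ) +
      ∫ t, inner ℂ (f t) (g' t) ∂(weightedMeasure κ) -
      κ * ∫ t, inner ℂ (f t) (g t) ∂(weightedMeasure κ) := by
    have i12 : Integrable (fun t => inner ℂ (f' t) (g t) + inner ℂ (f t) (g' t))
        (weightedMeasure κ) := i1.add i2
    rw [← integral_add i1 i2, ← integral_const_mul, ← integral_sub i12 (i3.const_mul _)]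
  rw [← sub_eq_zero, ← hJ]
  have hfc : Continuous f := continuous_iff_continuousAt.mpr fun t => (hf t).continuousAt
  have hw : ∀ t, HasDerivAt (fun t => Real.exp (-κ * t) • f t)
      (Real.exp (-κ * t) • f' t + (Real.exp (-κ * t) * -κ) • f t) t := fun t => by
    have h1 : HasDerivAt (fun t => Real.exp (-κ * t)) (Real.exp (-κ * t) * -κ) t := by
      simpa using ((hasDerivAt_id t).const_mul (-κ)).exp
    exact h1.smul (hf t)
  have hparts : ∀ b, 0 ≤ b → ∫ t in (0 : ℝ)..b, Real.exp (-κ * t) • J t =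
      Real.exp (-κ * b) • inner ℂ (f b) (g b) := fun b hb => by
    have := integral_bilin_by_parts
      (isBoundedBilinearMap_inner (𝕜 := ℂ) (E := H)).toContinuousLinearMap hw
      (by fun_prop) hg hb
    simp only [IsBoundedBilinearMap.toContinuousLinearMap_apply, hf0, smul_zero, inner_zero_left,
      sub_zero] at this
    rw [inner_smul_left_eq_smul] at this
    rw [← this]
    refine intervalIntegral.integral_congr fun t _ => ?_
    simp only [J, inner_add_left, inner_smul_left_eq_smul, Complex.real_smul]
    push_cast
    ring
  have hint := (integrable_weightedMeasure_iff κ).mp iJ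
  have hlim := intervalIntegral_tendsto_integral_Ioi 0 hint Filter.tendsto_id
  rw [← integral_weightedMeasure] at hlim
  have hlim' : Filter.Tendsto (fun b => Real.exp (-κ * b) • inner ℂ (f b) (g b)) Filter.atTop
      (nhds (∫ t, J t ∂(weightedMeasure κ))) := by
    refine hlim.congr' ?_
    filter_upwards [Filter.eventually_ge_atTop 0] with b hb
    exact hparts b hb
  -- No decay at infinity is assumed: the boundary term has a limit because `J` is integrable, and
  -- the limit is `0` because the term is itself integrable on the half-line.
  refine IntegrableAtFilter.eq_zero_of_tendsto
    ⟨Ioi 0, Filter.Ioi_mem_atTop _, (integrable_weightedMeasure_iff κ).mp i3⟩ ?_ hlim'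
  intro s hs
  obtain ⟨b, hb⟩ := Filter.mem_atTop_sets.mp hs
  rw [← top_le_iff, ← Real.volume_Ici (a := b)]
  exact measure_mono hb

end EnergyIdentity

/-! ### Operators on `H` acting pointwise on `L₂`. -/

section Lift

variable {H : Type*} [NormedAddCommGroup H] [InnerProductSpace ℂ H] {α : Type*}
  [MeasurableSpace α] {μ : Measure α}

variable (μ) in
/-- The operator on `L₂` acting pointwise by `S`. -/
abbrev liftL2 (S : H →L[ℂ] H) : Lp H 2 μ →L[ℂ] Lp H 2 μ := S.compLpL 2 μ

theorem liftL2_one : liftL2 μ (1 : H →L[ℂ] H) = 1 := by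
  ext1 f
  exact Lp.ext (ContinuousLinearMap.coeFn_compLpL _ f)

theorem liftL2_mul (S S' : H →L[ℂ] H) : liftL2 μ (S * S') = liftL2 μ S * liftL2 μ S' := by
  ext1 f
  apply Lp.ext
  filter_upwards [(S * S').coeFn_compLpL f, S'.coeFn_compLpL f,
    S.coeFn_compLpL (S'.compLpL 2 μ f)] with t h1 h2 h3
  rw [h1, mul_apply_eq_comp, mul_apply_eq_comp, h3, h2]

theorem liftL2_pow (S : H →L[ℂ] H) (n : ℕ) : liftL2 μ (S ^ n) = liftL2 μ S ^ n := by
  induction n with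
  | zero => rw [pow_zero, pow_zero, liftL2_one]
  | succ n ih => rw [pow_succ, pow_succ, liftL2_mul, ih]

theorem liftL2_add_smul_one (S : H →L[ℂ] H) (c : ℂ) :
    liftL2 μ (S + c • 1) = liftL2 μ S + c • 1 := by
  rw [← liftL2_one, liftL2, ContinuousLinearMap.add_compLpL, ContinuousLinearMap.smul_compLpL]

theorem inner_liftL2_left {S : H →L[ℂ] H} (hS : ∀ x y, inner ℂ (S x) y = inner ℂ x (S y))
    (f g : Lp H 2 μ) : inner ℂ (liftL2 μ S f) g = inner ℂ f (liftL2 μ S g) := by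
  rw [L2.inner_def, L2.inner_def]
  refine integral_congr_ae ?_
  filter_upwards [S.coeFn_compLpL f, S.coeFn_compLpL g] with t h1 h2
  rw [h1, h2, hS]

theorem inner_liftL2_nonneg {S : H →L[ℂ] H} (hS : ∀ x, 0 ≤ (inner ℂ (S x) x).re)
    (f : Lp H 2 μ) : 0 ≤ (inner ℂ (liftL2 μ S f) f).re := by
  rw [L2.inner_def]
  have h := integral_re (𝕜 := ℂ) (L2.integrable_inner (𝕜 := ℂ) (liftL2 μ S f) f)
  simp only [RCLike.re_to_complex] at h
  rw [← h]
  refine integral_nonneg_of_ae ?_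
  filter_upwards [S.coeFn_compLpL f] with t h1
  rw [h1]
  exact hS _

theorem liftL2_injective {S : H →L[ℂ] H} (hS : Function.Injective S) :
    Function.Injective (liftL2 μ S) := by
  intro f g hfg
  apply Lp.ext
  filter_upwards [S.coeFn_compLpL (p := 2) f, S.coeFn_compLpL (p := 2) g] with t h1 h2
  rw [← show S.compLpL 2 μ f = S.compLpL 2 μ g from hfg, h1] at h2
  exact hS h2

end Lift

/-! ### The intermediate derivative theorem for `W^4_{2,κ}` with vanishing traces. -/

section Intermediate

variable {H : Type*} [NormedAddCommGroup H] [InnerProductSpace ℂ H]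

theorem locallyIntegrableOn_of_L2w {E : Type*} [NormedAddCommGroup E] {κ : ℝ} (f : L2w E κ) :
    LocallyIntegrableOn f (Ioi 0) := by
  rw [locallyIntegrableOn_iff isOpen_Ioi.isLocallyClosed]
  intro K hK hKc
  obtain ⟨a, b, ha, hab, h⟩ := exists_Icc_of_isCompact_subset_Ioi hKc hK
  have h1 := (intervalIntegrable_indicator_of_memLp (Lp.memLp f) 0 b).1
  have h2 : IntegrableOn f (Ioc 0 b) := h1.congr_fun
    (fun t ht => indicator_of_mem (show t ∈ Ioi (0 : ℝ) from ht.1) _) measurableSet_Ioc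
  exact h2.mono_set fun t ht => ⟨hK ht, (h ht).2⟩

theorem hasWeakDeriv_zero_self {u : ℝ → H} (hu : LocallyIntegrableOn u (Ioi 0)) :
    HasWeakDeriv 0 u u :=
  ⟨hu, hu, by simp⟩

/-- The derivatives of `u` in the subspace with vanishing traces lie in `L_{2,κ}` and satisfy the
energy identities. -/
theorem exists_derivatives_L2w [CompleteSpace H] {A : H →ₗ.[ℂ] H} {κ : ℝ} (u : W4 A κ)
    (h0 : ∀ s < 3, HasZeroTrace s (u : L2w H κ)) :
    ∃ U : ℕ → L2w H κ, U 0 = u ∧ U 4 = deriv4 u ∧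
      (∀ k ≤ 4, HasWeakDeriv k (u : L2w H κ) (U k)) ∧
      ∀ S : H →L[ℂ] H, ∀ k < 3,
        inner ℂ (U (k + 1)) (liftL2 _ S (U (k + 1))) + inner ℂ (U k) (liftL2 _ S (U (k + 2))) =
          κ * inner ℂ (U k) (liftL2 _ S (U (k + 1))) := by
  set v := deriv4 u
  have hv : HasWeakDeriv 4 (u : L2w H κ) v := u.2.1.choose_spec
  have hvi : (v : ℝ → H) =ᵐ[volume.restrict (Ioi 0)] (Ioi 0).indicator v := by
    filter_upwards [ae_restrict_mem measurableSet_Ioi] with t ht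
    rw [indicator_of_mem ht]
  have hvi' : (v : ℝ → H) =ᵐ[weightedMeasure κ] (Ioi 0).indicator v := by
    rw [Filter.EventuallyEq, ae_weightedMeasure]; exact hvi
  obtain ⟨d, hd4, hp, hw⟩ := (hv.congr (ae_eq_refl _) hvi).exists_derivatives
    (intervalIntegrable_indicator_of_memLp (Lp.memLp v))
  have hm : ∀ k ≤ 4, MemLp (d k) 2 (weightedMeasure κ) := fun k hk =>
    memLp_derivatives (Lp.stronglyMeasurable _) (Lp.memLp (u : L2w H κ))
      (by rw [hd4]; exact (Lp.stronglyMeasurable v).indicator measurableSet_Ioi)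
      (by rw [hd4]; exact (memLp_congr_ae hvi').mp (Lp.memLp v)) hp hw hk
  -- Two representatives continuous on `[0, ∞)` and equal almost everywhere agree also at `0`.
  have hd0 : ∀ k < 3, d k 0 = 0 := fun k hk => by
    obtain ⟨g, hg, hgc, hg0⟩ := h0 k hk
    have h1 := (hw k (by omega)).unique hg
    rw [restrict_Ioi_eq_restrict_Ici] at h1
    rw [Measure.eqOn_of_ae_eq h1 (hp k (by omega)).continuous.continuousOn hgc
      (by rw [interior_Ici, closure_Ioi]) self_mem_Ici, hg0]
  let U : ℕ → L2w H κ := fun k => if hk : k ≤ 4 then (hm k hk).toLp (d k) else 0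
  have hU : ∀ k (hk : k ≤ 4), U k = (hm k hk).toLp (d k) := fun k hk => dif_pos hk
  have hUd : ∀ k ≤ 4, (U k : ℝ → H) =ᵐ[weightedMeasure κ] d k := fun k hk => by
    rw [hU k hk]; exact (hm k hk).coeFn_toLp
  refine ⟨U, ?_, ?_, fun k hk => ?_, fun S k hk => ?_⟩
  · apply Lp.ext
    refine (hUd 0 (by norm_num)).trans ?_
    rw [Filter.EventuallyEq, ae_weightedMeasure]
    exact (hw 0 (by norm_num)).unique (hasWeakDeriv_zero_self (locallyIntegrableOn_of_L2w _))
  · apply Lp.ext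
    refine (hUd 4 le_rfl).trans ?_
    rw [hd4]; exact hvi'.symm
  · refine (hw k hk).congr (ae_eq_refl _) ?_
    have := (hUd k hk).symm
    rwa [Filter.EventuallyEq, ae_weightedMeasure] at this
  · have hS : ∀ l (hl : l ≤ 4), liftL2 _ S (U l) = (S.comp_memLp' (hm l hl)).toLp _ := by
      intro l hl
      apply Lp.ext
      filter_upwards [S.coeFn_compLpL (U l), hUd l hl,
        (S.comp_memLp' (hm l hl)).coeFn_toLp] with t e1 e2 e3
      rw [e1, e2, e3]; rfl
    rw [hU (k + 1) (by omega), hU k (by omega), ← hU (k + 1) (by omega), hS (k + 1) (by omega),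
      hS (k + 2) (by omega), hU (k + 1) (by omega), inner_toLp, inner_toLp, inner_toLp]
    -- Here `f = u^{(k)}` and `g = S u^{(k+1)}`. For `k = 2` the function `g'` involves `u''''`,
    -- which is only in `L_{2,κ}`; hence the primitive formulation for `g`.
    exact integral_inner_deriv_add
      (fun t => (hp k (by omega)).hasDerivAt (hp (k + 1) (by omega)).continuous t)
      (hp (k + 1) (by omega)).continuous (hd0 k hk)
      ((hp (k + 1) (by omega)).clm_comp (S.restrictScalars ℝ)) (hm k (by omega))
      (hm (k + 1) (by omega)) (S.comp_memLp' (hm (k + 1) (by omega)))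
      (S.comp_memLp' (hm (k + 2) (by omega)))

/-- The intermediate derivative theorem in the subspace with vanishing traces: `A ^ j` applied to
the derivative of order `4 - j` lies in `L_{2,κ}`, with a bound by the norm of `W^4_{2,κ}`. -/
theorem exists_intermediate_L2w [CompleteSpace H] {A : H →ₗ.[ℂ] H} {T : H →L[ℂ] H}
    (hTA : ∀ x y, (x, y) ∈ A.graph ↔ T y = x)
    (hT : ∀ x y, inner ℂ (T x) y = inner ℂ x (T y)) (hT0 : ∀ x, 0 ≤ (inner ℂ (T x) x).re)
    (κ : ℝ) : ∃ C : ℝ, 0 ≤ C ∧ ∀ u : W4 A κ, (∀ s < 3, HasZeroTrace s (u : L2w H κ)) →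
      ∀ j ∈ Finset.Icc 1 4, ∃ y : L2w H κ,
        HasWeakDeriv (4 - j) (u : L2w H κ) (fun t => (T ^ j) (y t)) ∧
        ‖y‖ ≤ C * (‖pow4 u‖ + ‖deriv4 u‖) := by
  set K := |κ| * (‖liftL2 (weightedMeasure κ) T‖ + 1)
  have hK : 0 ≤ K := by positivity
  have hC : 1 ≤ interpConst K := by
    unfold interpConst
    nlinarith [one_le_pow₀ (n := 3) (show 1 ≤ K + 1 by linarith)]
  refine ⟨interpConst K, by linarith, fun u h0 j hj => ?_⟩
  have hinj : Function.Injective T := by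
    intro a b hab
    exact LinearPMap.mem_graph_snd_inj A ((hTA _ a).mpr rfl) ((hTA _ b).mpr rfl) hab
  obtain ⟨U, hU0, hU4, hUw, hUS⟩ := exists_derivatives_L2w u h0
  have hpow : ∀ (n : ℕ) (y : L2w H κ),
      ((liftL2 (weightedMeasure κ) T ^ n) y : ℝ → H) =ᵐ[weightedMeasure κ]
        fun t => (T ^ n) (y t) := fun n y => by
    rw [← liftL2_pow]; exact (T ^ n).coeFn_compLpL y
  have hw : U 0 = (liftL2 (weightedMeasure κ) T ^ 4) (pow4 u) := by
    rw [hU0]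
    apply Lp.ext
    filter_upwards [hpow 4 (pow4 u), u.2.2.choose_spec] with t h1 h2
    rw [h1]
    exact ((mem_graph_opPow hTA 4 _ _).mp h2).symm
  have hres : ∀ ε : ℝ, 0 < ε → ∃ G : L2w H κ →L[ℂ] L2w H κ,
      G * (liftL2 (weightedMeasure κ) T + (ε : ℂ) • 1) = 1 ∧
      (liftL2 (weightedMeasure κ) T + (ε : ℂ) • 1) * G = 1 ∧ ∀ k < 3, ∀ n,
        inner ℂ (U (k + 1)) ((G ^ n) (U (k + 1))) + inner ℂ (U k) ((G ^ n) (U (k + 2))) =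
          κ * inner ℂ (U k) ((G ^ n) (U (k + 1))) := fun ε hε => by
    -- The resolvent is taken on `H` and then lifted, so that its powers act pointwise and the
    -- energy identities apply to them.
    obtain ⟨G, hG, hG'⟩ := exists_resolvent hT hT0 hε
    refine ⟨liftL2 _ G, ?_, ?_, fun k hk n => ?_⟩
    · rw [← liftL2_add_smul_one, ← liftL2_mul, hG, liftL2_one]
    · rw [← liftL2_add_smul_one, ← liftL2_mul, hG', liftL2_one]
    · rw [← liftL2_pow]; exact hUS (G ^ n) k hk
  have key : ∃ y, (liftL2 (weightedMeasure κ) T ^ j) y = U (4 - j) ∧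
      ‖y‖ ≤ interpConst K * (‖pow4 u‖ + ‖deriv4 u‖) := by
    rw [Finset.mem_Icc] at hj
    -- For `j = 4` the preimage is `A⁴u` itself, and the bound needs the constant to be at least
    -- `1`.
    rcases hj.2.eq_or_lt with rfl | hj4
    · refine ⟨pow4 u, hw.symm, ?_⟩
      nlinarith [norm_nonneg (pow4 u), norm_nonneg (deriv4 u)]
    · have := exists_intermediate (inner_liftL2_left hT) (inner_liftL2_nonneg hT0)
        (liftL2_injective hinj) hw hres (k := 3 - j) (by omega)
      rw [show 3 - j + 1 = 4 - j by omega, show 4 - (4 - j) = j by omega, hU4] at this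
      exact this
  obtain ⟨y, hy, hyn⟩ := key
  refine ⟨y, (hUw (4 - j) (by omega)).congr (ae_eq_refl _) ?_, hyn⟩
  have := hpow j y
  rwa [hy, Filter.EventuallyEq, ae_weightedMeasure] at this

/-- `u ↦ A ^ j u^{(4 - j)}` as a bounded linear operator on the subspace with vanishing traces. -/
theorem exists_linearMap_intermediate [CompleteSpace H] {A : H →ₗ.[ℂ] H} {T : H →L[ℂ] H}
    (hTA : ∀ x y, (x, y) ∈ A.graph ↔ T y = x)
    (hT : ∀ x y, inner ℂ (T x) y = inner ℂ x (T y)) (hT0 : ∀ x, 0 ≤ (inner ℂ (T x) x).re)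
    (κ : ℝ) : ∃ C : ℝ, 0 ≤ C ∧ ∀ j ∈ Finset.Icc 1 4, ∃ Y : W4Zero A κ →ₗ[ℂ] L2w H κ,
      ∀ u : W4Zero A κ,
        HasWeakDeriv (4 - j) (u : L2w H κ) (fun t => (T ^ j) (Y u t)) ∧
        ‖Y u‖ ≤ C * W4norm (⟨(u : L2w H κ), u.2.1⟩ : W4 A κ) := by
  obtain ⟨C, hC, h⟩ := exists_intermediate_L2w hTA hT hT0 κ
  refine ⟨C * 2, by positivity, fun j hj => ?_⟩
  choose Y hY hYn using fun u : W4Zero A κ => h ⟨u, u.2.1⟩ u.2.2 j hj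
  -- Uniqueness of weak derivatives and injectivity of `T ^ j` determine `Y u`, which makes the
  -- chosen map linear.
  have huniq : ∀ (u : W4Zero A κ) (y : L2w H κ),
      HasWeakDeriv (4 - j) (u : L2w H κ) (fun t => (T ^ j) (y t)) → Y u = y := by
    intro u y hy
    have h1 := (hY u).unique hy
    rw [Filter.EventuallyEq, ← ae_weightedMeasure κ] at h1
    apply Lp.ext
    filter_upwards [h1] with t ht
    exact LinearPMap.mem_graph_snd_inj _ ((mem_graph_opPow hTA j _ _).mpr rfl)
      ((mem_graph_opPow hTA j _ _).mpr rfl) ht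
  have hae : ∀ {f g : ℝ → H}, f =ᵐ[weightedMeasure κ] g → f =ᵐ[volume.restrict (Ioi 0)] g := by
    intro f g hfg
    rwa [Filter.EventuallyEq, ← ae_weightedMeasure κ]
  refine ⟨⟨⟨Y, fun u u' => huniq _ _ ?_⟩, fun c u => huniq _ _ ?_⟩, fun u => ⟨hY u, ?_⟩⟩
  · refine ((hY u).add (hY u')).congr (hae (Lp.coeFn_add _ _).symm) (hae ?_)
    filter_upwards [Lp.coeFn_add (Y u) (Y u')] with t ht
    rw [ht, Pi.add_apply, Pi.add_apply, map_add]
  · refine ((hY u).smul c).congr (hae (Lp.coeFn_smul _ _).symm) (hae ?_)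
    filter_upwards [Lp.coeFn_smul c (Y u)] with t ht
    rw [RingHom.id_apply, ht, Pi.smul_apply, Pi.smul_apply, map_smul]
  · refine (hYn u).trans ?_
    rw [mul_assoc]
    refine mul_le_mul_of_nonneg_left ?_ hC
    unfold W4norm
    set a := ‖pow4 (⟨(u : L2w H κ), u.2.1⟩ : W4 A κ)‖
    set b := ‖deriv4 (⟨(u : L2w H κ), u.2.1⟩ : W4 A κ)‖
    have h1 : a ≤ Real.sqrt (b ^ 2 + a ^ 2) := Real.le_sqrt_of_sq_le (by nlinarith [sq_nonneg b])
    have h2 : b ≤ Real.sqrt (b ^ 2 + a ^ 2) := Real.le_sqrt_of_sq_le (by nlinarith [sq_nonneg a])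
    linarith

end Intermediate

end WeightedSobolev

end

/-! ### Assembly of the perturbation operator. -/

theorem mainTheorem3 {H : Type*} [NormedAddCommGroup H] [InnerProductSpace ℂ H] [CompleteSpace H]
    [TopologicalSpace.SeparableSpace H]
    (A : H →ₗ.[ℂ] H) (hA : IsSelfAdjoint A)
    (lam : ℝ) (hlam : 0 < lam)
    (hpos : ∀ x : A.domain, lam * ‖(x : H)‖ ^ 2 ≤ (inner ℂ (A x) (x : H)).re)
    (κ : ℝ) (B : ℕ → (H →ₗ.[ℂ] H))
    (hB : ∀ j ∈ Finset.Icc 1 4, WeightedSobolev.IsBoundedIn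
      (WeightedSobolev.opComp (B j) (WeightedSobolev.opPow A j).inverse)) :
    ∃ P₁ : WeightedSobolev.W4Zero A κ →ₗ[ℂ] WeightedSobolev.L2w H κ,
      (∀ u : WeightedSobolev.W4Zero A κ,
        WeightedSobolev.IsPerturbation B κ (u : WeightedSobolev.L2w H κ) (P₁ u)) ∧
      ∃ C : ℝ, ∀ u : WeightedSobolev.W4Zero A κ,
        ‖P₁ u‖ ≤ C * WeightedSobolev.W4norm
          (⟨(u : WeightedSobolev.L2w H κ), u.2.1⟩ : WeightedSobolev.W4 A κ) := by
  obtain ⟨T, hTA, hT, hT0⟩ := WeightedSobolev.exists_bounded_inverse A hA hlam hpos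
  obtain ⟨C, hC, h⟩ := WeightedSobolev.exists_linearMap_intermediate hTA hT hT0 κ
  choose! Y hY using h
  have hQ' := fun j hj => WeightedSobolev.exists_clm_of_isBoundedIn hTA j (B j) (hB j hj)
  choose! Q hQ using hQ'
  -- `Q j` is `A_j A⁻ʲ` and `Y j u` is `A ^ j u^{(4-j)}`, so each summand is `A_j u^{(4-j)}`.
  refine ⟨∑ j ∈ Finset.Icc 1 4, ((Q j).compLpL 2 _).toLinearMap ∘ₗ Y j, fun u => ?_,
    ∑ j ∈ Finset.Icc 1 4, ‖Q j‖ * C, fun u => ?_⟩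
  · refine ⟨fun k t => (T ^ (4 - k)) (Y (4 - k) u t), fun k hk => ?_, ?_⟩
    · have := (hY (4 - k) (by rw [Finset.mem_Icc]; omega) u).1
      rwa [show 4 - (4 - k) = k by omega] at this
    · have h1 : ∀ᵐ t ∂(WeightedSobolev.weightedMeasure κ), ∀ j ∈ Finset.Icc 1 4,
          ((Q j).compLpL 2 (WeightedSobolev.weightedMeasure κ) (Y j u)) t = Q j (Y j u t) := by
        rw [Filter.eventually_all_finset]
        exact fun j _ => (Q j).coeFn_compLpL (Y j u)
      filter_upwards [h1, Lp.coeFn_fun_finsetSum (Finset.Icc 1 4) fun j =>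
        (Q j).compLpL 2 (WeightedSobolev.weightedMeasure κ) (Y j u)] with t h1 h2
      refine ⟨fun j => Q j (Y j u t), fun j hj => ?_, ?_⟩
      · have hj' := Finset.mem_Icc.mp hj
        simp only [show 4 - (4 - j) = j by omega]
        exact hQ j hj _
      · rw [← Finset.sum_congr rfl h1, ← h2]
        simp only [LinearMap.sum_apply, LinearMap.comp_apply]
        rfl
  · simp only [LinearMap.sum_apply, LinearMap.comp_apply]
    rw [Finset.sum_mul]
    refine (norm_sum_le _ _).trans (Finset.sum_le_sum fun j hj => ?_)
    rw [mul_assoc]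
    refine (ContinuousLinearMap.norm_compLp_le (Q j) (Y j u)).trans ?_
    exact mul_le_mul_of_nonneg_left (hY j hj u).2 (norm_nonneg _)
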